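/- Let $R$ be a relation schema (a finite set of attributes). A table $T$ over $R$ is a finite list of tuples $t$ (repetitions allowed), where each $t[A]$, $A\in R$, is an element of the domain of $A$ or the null marker $\bot$. The active domain $VD_A$ is the set of values other than $\bot$ that occur in $T$ under $A$; if there is no such value, $VD_A=\{ssymb\}$ for a special symbol $ssymb$ contained in no domain. A strongly possible world of $T$ is a table without nulls obtained from $T$ by replacing each occurrence of $\bot$ under each attribute $A$ by an element of $VD_A$. A table $T'$ satisfies the cross join $X\times Y$ ($X,Y\subseteq R$) if for all $t_1,t_2\in T'$ there is $t\in T'$ with $t[X]=t_1[X]$ and $t[Y]=t_2[Y]$; and $T$ satisfies the strongly possible cross join $X\times_{sp}Y$ if some strongly possible world of $T$ satisfies $X\times Y$. (i) The following decision problem is in P (solvable on a Turing machine in time polynomial in the length of the input, where the values in the table are given as binary words). Input: a schema $R$, attributes $X,Y\in R$, and a table $T$ over $R$, possibly with nulls. Question: does $T$ satisfy $\{X\}\times_{sp}\{Y\}$? (ii) Let $T$ be a nonempty table over $R$ and let $X,Y\in R$. Let $G$ be the bipartite graph with partite classes $T$ (each occurrence of a tuple being one vertex) and $VD_X\times VD_Y$,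 in which $t\in T$ and $(a,b)\in VD_X\times VD_Y$ are adjacent if and only if $t$ is weakly similar to $(a,b)$ on $\{X,Y\}$, that is, $t[X]\in\{a,\bot\}$ and $t[Y]\in\{b,\bot\}$ (and $a=b$ in case $X=Y$). Then $T$ satisfies $\{X\}\times_{sp}\{Y\}$ if and only if $G$ has a matching that covers $VD_X\times VD_Y$. -/

import Mathlib

namespace SpCJ

universe u v

/-- A tuple over the schema (set of attributes) `R`, where `dom A` is the set of proper values of
the attribute `A`. The entry `none` is the null marker `⊥`. -/
abbrev Tuple (R : Type u) (dom : R → Type v) : Type (max u v) :=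
  (A : R) → Option (dom A)

/-- A table is a finite list of tuples; repeated tuples are allowed (bag semantics). -/
abbrev Table (R : Type u) (dom : R → Type v) : Type (max u v) :=
  List (Tuple R dom)

/-- A domain extended by the special symbol `ssymb`, which lies in no domain. -/
inductive Ext (D : Type v) : Type v
  | val (d : D) : Ext D
  | ssymb : Ext D

variable {R : Type u} {dom : R → Type v}

/-- Weak similarity of two tuples on a set `X` of attributes. -/
def WeaklySimilar (X : Set R) (t₁ t₂ : Tuple R dom) : Prop :=
  ∀ A ∈ X, t₁ A = t₂ A ∨ t₁ A = none ∨ t₂ A = none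

/-- A tuple without nulls. -/
def IsTotal (t : Tuple R dom) : Prop :=
  ∀ A, t A ≠ none

/-- The tuple `t`, read as a tuple over the extended domains. -/
def Tuple.toExt (t : Tuple R dom) : Tuple R (fun A => Ext (dom A)) :=
  fun A => (t A).map Ext.val

/-- The set of the values other than `⊥` that occur in the table under the attribute `A`. -/
def occurringValues (T : Table R dom) (A : R) : Set (dom A) :=
  {d | ∃ t ∈ T, t A = some d}

/-- The active domain `VD_A`: the values other than `⊥` that occur under `A`, where the symbol
`ssymb` is added in the degenerate case that there is no such value. -/
def activeDomain (T : Table R dom) (A : R) : Set (Ext (dom A)) :=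
  Ext.val '' occurringValues T A ∪ {e | e = Ext.ssymb ∧ occurringValues T A = ∅}

/-- `T'` arises from `T`, tuple by tuple, by replacing each null by a value. -/
def IsPossibleWorld (T : Table R dom) (T' : Table R (fun A => Ext (dom A))) : Prop :=
  List.Forall₂ (fun t t' => WeaklySimilar Set.univ (Tuple.toExt t) t') T T' ∧
    ∀ t' ∈ T', IsTotal t'

/-- A strongly possible world: a possible world all of whose values come from the active
domains of `T`. -/
def IsSpWorld (T : Table R dom) (T' : Table R (fun A => Ext (dom A))) : Prop :=
  IsPossibleWorld T T' ∧ ∀ t' ∈ T', ∀ A, ∃ a ∈ activeDomain T A, t' A = some a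

/-- The table `T` satisfies the cross join `X × Y`. -/
def SatisfiesCJ (T : Table R dom) (X Y : Set R) : Prop :=
  ∀ t₁ ∈ T, ∀ t₂ ∈ T, ∃ t ∈ T, (∀ A ∈ X, t A = t₁ A) ∧ (∀ A ∈ Y, t A = t₂ A)

/-- The table `T` satisfies the strongly possible cross join `X ×_sp Y`. -/
def SatisfiesSpCJ (T : Table R dom) (X Y : Set R) : Prop :=
  ∃ T' : Table R (fun A => Ext (dom A)), IsSpWorld T T' ∧ SatisfiesCJ T' X Y

/-! ### The bipartite graph of tuples and value pairs -/

/-- The vertices: the (positions of the) tuples of `T` on the left, and the pairs in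
`VD_X × VD_Y` on the right. -/
abbrev PairVertex (T : Table R dom) (X Y : R) : Type v :=
  Fin T.length ⊕ (activeDomain T X × activeDomain T Y)

/-- The tuple `t` is weakly similar on `{X, Y}` to the pair `(a, b)`, that is, to a tuple with
value `a` at `X` and value `b` at `Y`. (If `X = Y`, this requires `a = b`.) -/
def SimilarToPair (t : Tuple R dom) (X Y : R) (a : Ext (dom X)) (b : Ext (dom Y)) : Prop :=
  ∃ s : Tuple R (fun A => Ext (dom A)),
    s X = some a ∧ s Y = some b ∧ WeaklySimilar {X, Y} (Tuple.toExt t) s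

/-- The bipartite graph that joins a tuple to the pairs it is weakly similar to on `{X, Y}`. -/
def pairGraph (T : Table R dom) (X Y : R) : SimpleGraph (PairVertex T X Y) :=
  SimpleGraph.fromRel fun u v =>
    ∃ (i : Fin T.length) (a : activeDomain T X) (b : activeDomain T Y),
      u = Sum.inl i ∧ v = Sum.inr (a, b) ∧ SimilarToPair (T.get i) X Y a.1 b.1

/-! ### The decision problem -/

/-- An instance: a schema with `n` attributes, two attributes `X` and `Y` of it, and an
incomplete table over it with values in `D`. -/
structure Instance (D : Type) where
  n : ℕ
  X : Fin n
  Y : Fin n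
  T : Table (Fin n) (fun _ => D)

/-- The question of the problem "Singular spCJ". -/
def Instance.Yes {D : Type} (I : Instance D) : Prop :=
  SatisfiesSpCJ I.T {I.X} {I.Y}

open Computability (Γ')

/-- A table entry, terminated by a comma; `code` writes a value as a binary word, and the null
is written as the blank symbol. -/
def encodeEntry {D : Type} (code : D → List Bool) : Option D → List Γ'
  | none => [Γ'.blank, Γ'.comma]
  | some d => (code d).map Γ'.bit ++ [Γ'.comma]

/-- A tuple: the list of its entries, between brackets. -/
def encodeTuple {D : Type} (code : D → List Bool) {n : ℕ} (t : Fin n → Option D) : List Γ' :=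
  Γ'.bra :: ((List.ofFn t).flatMap (encodeEntry code) ++ [Γ'.ket])

/-- The schema, with `X` and `Y` marked in it: for each attribute, one bit that tells whether it
is `X` and one bit that tells whether it is `Y`. -/
def encodeSchema {n : ℕ} (X Y : Fin n) : List Γ' :=
  (List.finRange n).flatMap fun A => [Γ'.bit (decide (A = X)), Γ'.bit (decide (A = Y))]

/-- An instance as a word over a finite alphabet: the schema, followed by the tuples. -/
def Instance.encode {D : Type} (code : D → List Bool) (I : Instance D) : List Γ' :=
  encodeSchema I.X I.Y ++ I.T.flatMap (encodeTuple code)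

open Classical in
/-- The decision problem with instances `a : α`, written as words `enc a`, and question `p` is
in `P`: some Turing machine (with finitely many stacks) answers it, in a number of steps that is
at most a polynomial in the length of the word. -/
def InP {α Γ : Type} (enc : α → List Γ) (p : α → Prop) : Prop :=
  Nonempty (Turing.TM2ComputableInPolyTime enc Computability.encodeBool (fun a => decide (p a)))

end SpCJ

universe u v

/-! Combinatorics. In a strongly possible world of a nonempty table every value of an active domain
still occurs. So if the world satisfies the cross join, each pair in `VD_X × VD_Y` is read off at
`X`, `Y` from some tuple, and different pairs need different tuples. Conversely, given an injective
choice of weakly similar tuples, write each pair into its tuple and fill all other nulls from the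
active domains. No values outside the active domains appear, so every combination required by the
cross join is one of the pairs already written. This is `SpCJ.satisfiesSpCJ_iff`; such injections
are the matchings of the graph (`exists_injective_iff_exists_isMatching`).

Algorithm. The matching problem is decided by an auction, each round of which is one scan of a list.
Every tuple is a slot with a price, initially 0. An unmatched cell takes its cheapest adjacent slot,
raises the price by one, and sends a previous owner back to the queue. Each bid raises the sum of
the prices, and no price exceeds `|T| + 1`, so the auction is stationary after polynomially many
rounds. An empty queue gives a matching. If a cell is stuck, some number up to `|T|` is not a price;
the owners of the slots above this gap together with the stuck cell violate Hall's condition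
(`Auction.Inv.not_matchable`).

Complexity. Structured programs on five stacks are compiled to a stack machine, step for step
(`Exec.iterate_step`). Data are binary trees written in preorder. A function is `PT` if some program
replaces the tree on top of the main stack by its value in polynomial time, leaves everything below
and on the other stacks intact, and the value has polynomial size. These functions are closed under
composition, pairing, case distinction, and folds with polynomially bounded intermediate results
(`PT.foldl`). Parser and auction are then ordinary list functions, and it remains to show that they
are `PT` (`PT.decideWord`) and correct on encoded instances (`decideWord_encode`). -/

open Computability (Γ')

/-! ### Structured stack programs and their compilation. -/

namespace TreeMachine

/-- The stacks of the machine: the input, the main stack, two stacks for saved values, and a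
counter. -/
inductive Stk
  | I | V | W | Z | C
  deriving DecidableEq

instance : Fintype Stk :=
  ⟨{.I, .V, .W, .Z, .C}, by rintro (_ | _ | _ | _ | _) <;> decide⟩

/-- The contents of the stacks, together with the symbol that was popped last. -/
structure State where
  v : Option Γ'
  I : List Γ'
  V : List Γ'
  W : List Γ'
  Z : List Γ'
  C : List Γ'

/-- The content of a stack. -/
def State.get (s : State) : Stk → List Γ'
  | .I => s.I
  | .V => s.V
  | .W => s.W
  | .Z => s.Z
  | .C => s.C

/-- Replace the content of a stack. -/
def State.set (s : State) : Stk → List Γ' → State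
  | .I, l => { s with I := l }
  | .V, l => { s with V := l }
  | .W, l => { s with W := l }
  | .Z, l => { s with Z := l }
  | .C, l => { s with C := l }

/-- Structured programs on the stacks. -/
inductive Cmd
  | skip
  | push (k : Stk) (a : Γ')
  | pop (k : Stk)
  | seq (c₁ c₂ : Cmd)
  | ite (p : Option Γ' → Bool) (c₁ c₂ : Cmd)
  | loop (p : Option Γ' → Bool) (c : Cmd)

infixr:60 " ;; " => Cmd.seq

/-- `Exec c s s' n`: the program `c` leads from the state `s` to the state `s'` in `n` steps. -/
inductive Exec : Cmd → State → State → ℕ → Prop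
  | skip (s) : Exec .skip s s 1
  | push (k a s) : Exec (.push k a) s (s.set k (a :: s.get k)) 1
  | pop (k s) : Exec (.pop k) s { s.set k (s.get k).tail with v := (s.get k).head? } 1
  | seq {c₁ c₂ s₁ s₂ s₃ n m} (h₁ : Exec c₁ s₁ s₂ n) (h₂ : Exec c₂ s₂ s₃ m) :
      Exec (c₁ ;; c₂) s₁ s₃ (n + m)
  | ite_true {p c₁ c₂ s s' n} (h : p s.v = true) (h₁ : Exec c₁ s s' n) :
      Exec (.ite p c₁ c₂) s s' (n + 1)
  | ite_false {p c₁ c₂ s s' n} (h : p s.v = false) (h₁ : Exec c₂ s s' n) :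
      Exec (.ite p c₁ c₂) s s' (n + 1)
  | loop_false {p c s} (h : p s.v = false) : Exec (.loop p c) s s 1
  | loop_true {p c s₁ s₂ s₃ n m} (h : p s₁.v = true) (h₁ : Exec c s₁ s₂ n)
      (h₂ : Exec (.loop p c) s₂ s₃ m) : Exec (.loop p c) s₁ s₃ (m + n + 1)

/-- The labels of the compiled program. -/
def Cmd.Lbl : Cmd → Type
  | .skip => Unit
  | .push _ _ => Unit
  | .pop _ => Unit
  | .seq c₁ c₂ => c₁.Lbl ⊕ c₂.Lbl
  | .ite _ c₁ c₂ => Unit ⊕ (c₁.Lbl ⊕ c₂.Lbl)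
  | .loop _ c => Unit ⊕ c.Lbl

theorem Cmd.finite_lbl : ∀ c : Cmd, Finite c.Lbl
  | .skip => inferInstanceAs (Finite Unit)
  | .push _ _ => inferInstanceAs (Finite Unit)
  | .pop _ => inferInstanceAs (Finite Unit)
  | .seq c₁ c₂ =>
    have := finite_lbl c₁
    have := finite_lbl c₂
    inferInstanceAs (Finite (c₁.Lbl ⊕ c₂.Lbl))
  | .ite _ c₁ c₂ =>
    have := finite_lbl c₁
    have := finite_lbl c₂
    inferInstanceAs (Finite (Unit ⊕ (c₁.Lbl ⊕ c₂.Lbl)))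
  | .loop _ c =>
    have := finite_lbl c
    inferInstanceAs (Finite (Unit ⊕ c.Lbl))

/-- The label at which the compiled program starts. -/
def Cmd.entry : (c : Cmd) → c.Lbl
  | .skip => ()
  | .push _ _ => ()
  | .pop _ => ()
  | .seq c₁ _ => .inl c₁.entry
  | .ite _ _ _ => .inl ()
  | .loop _ _ => .inl ()

/-- The stack alphabets; the additional stack `none` is for the output. -/
def Alphabet : Option Stk → Type
  | none => Bool
  | some _ => Γ'

/-- The statements of the compiled program, where `e` embeds its labels into those of the whole
machine and `x` is the label to go to at the end. -/
def Cmd.stmt {L : Type} : (c : Cmd) → (c.Lbl → L) → L → c.Lbl →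
    Turing.TM2.Stmt Alphabet L (Option Γ')
  | .skip, _, x, _ => .goto fun _ => x
  | .push k a, _, x, _ => .push (some k) (fun _ => a) (.goto fun _ => x)
  | .pop k, _, x, _ => .pop (some k) (fun _ b => b) (.goto fun _ => x)
  | .seq c₁ c₂, e, _, .inl l => c₁.stmt (e ∘ .inl) (e (.inr c₂.entry)) l
  | .seq _ c₂, e, x, .inr l => c₂.stmt (e ∘ .inr) x l
  | .ite p c₁ c₂, e, _, .inl _ =>
    .branch p (.goto fun _ => e (.inr (.inl c₁.entry))) (.goto fun _ => e (.inr (.inr c₂.entry)))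
  | .ite _ c₁ _, e, x, .inr (.inl l) => c₁.stmt (e ∘ .inr ∘ .inl) x l
  | .ite _ _ c₂, e, x, .inr (.inr l) => c₂.stmt (e ∘ .inr ∘ .inr) x l
  | .loop p c, e, x, .inl _ =>
    .branch p (.goto fun _ => e (.inr c.entry)) (.goto fun _ => x)
  | .loop _ c, e, _, .inr l => c.stmt (e ∘ .inr) (e (.inl ())) l

/-- The stacks of the compiled machine. -/
def State.stk (s : State) : (k : Option Stk) → List (Alphabet k)
  | none => []
  | some k => s.get k

/-- The configuration of the compiled machine. -/
def State.cfg {L : Type} (s : State) (l : L) : Turing.TM2.Cfg Alphabet L (Option Γ') :=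
  ⟨some l, s.v, s.stk⟩

theorem State.update_stk (s : State) (k : Stk) (l : List (Alphabet (some k))) :
    Function.update s.stk (some k) l = (s.set k l).stk := by
  funext k'
  rcases k' with _ | k'
  · simp [Function.update, State.stk]
  · by_cases h : k' = k
    · subst h
      refine (Function.update_self ..).trans ?_
      cases k' <;> rfl
    · refine (Function.update_of_ne (by simpa using h) ..).trans ?_
      cases k <;> cases k' <;> first | rfl | exact absurd rfl h

theorem State.set_v (s : State) (k : Stk) (l : List Γ') : (s.set k l).v = s.v := by
  cases k <;> rfl

theorem State.stk_v (s : State) (v : Option Γ') : State.stk { s with v := v } = s.stk := by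
  funext k
  rcases k with _ | k
  · rfl
  · cases k <;> rfl

theorem iterate_trans {α : Type*} {f : α → α} {a b c : α} {n m : ℕ} (h₁ : f^[n] a = b)
    (h₂ : f^[m] b = c) : f^[n + m] a = c := by
  rw [Nat.add_comm, Function.iterate_add_apply, h₁, h₂]

/-- The embedding `e` and the exit label `x` are arbitrary, so that the induction hypothesis applies
to a subprogram wherever it sits: the exit of the first part of a sequence is the entry of the
second, and the exit of a loop body is the head of the loop. Each rule of `Exec` counts exactly the
machine steps used. -/
theorem Exec.iterate_step {L : Type} (M : L → Turing.TM2.Stmt Alphabet L (Option Γ')) {c : Cmd}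
    {s s' : State} {n : ℕ} (h : Exec c s s' n) :
    ∀ (e : c.Lbl → L) (x : L), (∀ l, M (e l) = c.stmt e x l) →
      (flip bind (Turing.TM2.step M))^[n] (some (s.cfg (e c.entry))) = some (s'.cfg x) := by
  induction h with
  | skip s =>
    intro e x h
    simp [flip, State.cfg, h, Cmd.stmt]
  | push k a s =>
    intro e x h
    simp only [Function.iterate_one, flip, State.cfg, Option.bind_eq_bind, Option.bind_some,
      Turing.TM2.step, h, Cmd.stmt, Turing.TM2.stepAux, State.set_v]
    exact congrArg (fun S => some (⟨some x, s.v, S⟩ : Turing.TM2.Cfg Alphabet L (Option Γ')))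
      (s.update_stk k (a :: s.get k))
  | pop k s =>
    intro e x h
    simp only [Function.iterate_one, flip, State.cfg, Option.bind_eq_bind, Option.bind_some,
      Turing.TM2.step, h, Cmd.stmt, Turing.TM2.stepAux, State.stk_v]
    exact congrArg
      (fun S => some (⟨some x, (s.get k).head?, S⟩ : Turing.TM2.Cfg Alphabet L (Option Γ')))
      (s.update_stk k (s.get k).tail)
  | @seq c₁ c₂ s₁ s₂ s₃ n m h₁ h₂ ih₁ ih₂ =>
    intro e x h
    exact iterate_trans (ih₁ (e ∘ .inl) (e (.inr c₂.entry)) fun l => h (.inl l))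
      (ih₂ (e ∘ .inr) x fun l => h (.inr l))
  | @ite_true p c₁ c₂ s s' n hp h₁ ih =>
    intro e x h
    rw [Function.iterate_add_apply]
    convert ih (e ∘ .inr ∘ .inl) x fun l => h (.inr (.inl l)) using 2
    exact congrArg some
      (by simp [Cmd.entry, show M (e (.inl ())) = _ from h (.inl ()), Cmd.stmt, hp, State.cfg]; rfl)
  | @ite_false p c₁ c₂ s s' n hp h₁ ih =>
    intro e x h
    rw [Function.iterate_add_apply]
    convert ih (e ∘ .inr ∘ .inr) x fun l => h (.inr (.inr l)) using 2
    exact congrArg some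
      (by simp [Cmd.entry, show M (e (.inl ())) = _ from h (.inl ()), Cmd.stmt, hp, State.cfg]; rfl)
  | loop_false hp =>
    intro e x h
    exact congrArg some
      (by simp [Cmd.entry, show M (e (.inl ())) = _ from h (.inl ()), Cmd.stmt, hp, State.cfg])
  | @loop_true p c s₁ s₂ s₃ n m hp h₁ h₂ ih₁ ih₂ =>
    intro e x h
    have h1 : (flip bind (Turing.TM2.step M))^[1] (some (s₁.cfg (e (Cmd.loop p c).entry))) =
        some (s₁.cfg (e (.inr c.entry))) := by
      exact congrArg some
        (by simp [Cmd.entry, show M (e (.inl ())) = _ from h (.inl ()), Cmd.stmt, hp, State.cfg])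
    -- The count `m + n + 1` lists the later rounds first; it is reordered to test, body, later
    -- rounds.
    rw [Nat.add_assoc, Nat.add_comm]
    refine iterate_trans ?_ (ih₂ e x h)
    rw [Nat.add_comm]
    exact iterate_trans h1 (ih₁ (e ∘ .inr) (e (.inl ())) fun l => h (.inr l))

/-- Execution with a bound on the number of steps. -/
def Runs (c : Cmd) (s s' : State) (n : ℕ) : Prop :=
  ∃ m ≤ n, Exec c s s' m

/-- The initial state, with the given input. -/
def initial (w : List Γ') : State :=
  ⟨none, w, [], [], [], []⟩

/-- The machine that executes a program, and outputs the bit on the main stack. -/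
noncomputable def machine (c : Cmd) : Turing.FinTM2 where
  K := Option Stk
  k₀ := some .I
  k₁ := none
  Γ := Alphabet
  Λ := c.Lbl ⊕ Unit
  main := .inl c.entry
  ΛFin := @Fintype.ofFinite _ (have := c.finite_lbl; inferInstance)
  σ := Option Γ'
  initialState := none
  Γk₀Fin := inferInstanceAs (Fintype Γ')
  m := fun
    | .inl l => c.stmt .inl (.inr ()) l
    | .inr _ => .pop (some .V) (fun _ b => b)
      (.push none (fun v => decide (v = some (.bit true))) (.load (fun _ => none) .halt))

open Classical in
/-- A problem that is decided by a program in polynomial time is in `P`. -/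
theorem inP_of_runs {α : Type} (enc : α → List Γ') (p : α → Prop) (c : Cmd) (P : Polynomial ℕ)
    (h : ∀ a, ∃ v, Runs c (initial (enc a)) ⟨v, [], [.bit (decide (p a))], [], [], []⟩
      (P.eval (enc a).length)) : SpCJ.InP enc p := by
  refine ⟨{ tm := machine c, inputAlphabet := Equiv.refl _, outputAlphabet := Equiv.refl _,
            time := P + 1, outputsFun := fun a => ?_ }⟩
  choose v m hm hv using h
  -- The additional step is the final statement at the label `.inr ()`, which pops the answer,
  -- pushes it on the output stack, clears the register and halts.
  refine ⟨⟨m a + 1, ?_⟩, by simpa using hm a⟩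
  have h1 : Turing.initList (machine c) (List.map (Equiv.refl Γ').invFun (enc a)) =
      (initial (enc a)).cfg (.inl c.entry) := by
    simp only [Turing.initList, State.cfg]
    congr 1
    funext k
    rcases k with _ | k
    · rfl
    · cases k <;> first | rfl | skip
      exact List.map_id _
  refine iterate_trans
    ((congrArg _ (congrArg some h1)).trans ((hv a).iterate_step (machine c).m .inl (.inr ())
      fun l => rfl)) ?_
  simp only [flip, Function.iterate_one, Option.bind_eq_bind, Option.map_some]
  refine congrArg some ?_
  simp only [Turing.haltList, machine, Turing.TM2.stepAux]
  congr 1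
  funext k
  rcases k with _ | k
  · generalize decide (p a) = b
    cases b <;> rfl
  · cases k <;> rfl

namespace Runs

theorem mono {c : Cmd} {s s' : State} {n m : ℕ} (h : Runs c s s' n) (hm : n ≤ m) :
    Runs c s s' m :=
  let ⟨k, hk, h⟩ := h
  ⟨k, hk.trans hm, h⟩

theorem skip (s : State) : Runs .skip s s 1 :=
  ⟨1, le_rfl, .skip s⟩

theorem push (k : Stk) (a : Γ') (s : State) : Runs (.push k a) s (s.set k (a :: s.get k)) 1 :=
  ⟨1, le_rfl, .push k a s⟩

theorem pop (k : Stk) (s : State) :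
    Runs (.pop k) s { s.set k (s.get k).tail with v := (s.get k).head? } 1 :=
  ⟨1, le_rfl, .pop k s⟩

theorem seq {c₁ c₂ : Cmd} {s₁ s₂ s₃ : State} {n m : ℕ} (h₁ : Runs c₁ s₁ s₂ n)
    (h₂ : Runs c₂ s₂ s₃ m) : Runs (c₁ ;; c₂) s₁ s₃ (n + m) :=
  let ⟨k₁, hk₁, h₁⟩ := h₁
  let ⟨k₂, hk₂, h₂⟩ := h₂
  ⟨k₁ + k₂, by omega, .seq h₁ h₂⟩

theorem ite_true {p : Option Γ' → Bool} {c₁ c₂ : Cmd} {s s' : State} {n : ℕ} (h : p s.v = true)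
    (h₁ : Runs c₁ s s' n) : Runs (.ite p c₁ c₂) s s' (n + 1) :=
  let ⟨k₁, hk₁, h₁⟩ := h₁
  ⟨k₁ + 1, by omega, .ite_true h h₁⟩

theorem ite_false {p : Option Γ' → Bool} {c₁ c₂ : Cmd} {s s' : State} {n : ℕ} (h : p s.v = false)
    (h₁ : Runs c₂ s s' n) : Runs (.ite p c₁ c₂) s s' (n + 1) :=
  let ⟨k₁, hk₁, h₁⟩ := h₁
  ⟨k₁ + 1, by omega, .ite_false h h₁⟩

theorem loop_false {p : Option Γ' → Bool} {c : Cmd} {s : State} (h : p s.v = false) :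
    Runs (.loop p c) s s 1 :=
  ⟨1, le_rfl, .loop_false h⟩

theorem loop_true {p : Option Γ' → Bool} {c : Cmd} {s₁ s₂ s₃ : State} {n m : ℕ}
    (h : p s₁.v = true) (h₁ : Runs c s₁ s₂ n) (h₂ : Runs (.loop p c) s₂ s₃ m) :
    Runs (.loop p c) s₁ s₃ (n + m + 1) :=
  let ⟨k₁, hk₁, h₁⟩ := h₁
  let ⟨k₂, hk₂, h₂⟩ := h₂
  ⟨k₂ + k₁ + 1, by omega, .loop_true h h₁ h₂⟩

end Runs

/-! ### Binary trees on the stacks: moving, dropping and duplicating. -/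

/-- The data of the machine: binary trees. -/
inductive Tree
  | nil
  | cons (a b : Tree)

/-- A tree as a word, in preorder. -/
def Tree.word : Tree → List Γ'
  | .nil => [.bit false]
  | .cons a b => .bit true :: (a.word ++ b.word)

/-- The size of a tree: the length of its word. -/
def Tree.size (t : Tree) : ℕ :=
  t.word.length

@[simp]
theorem Tree.size_nil : Tree.nil.size = 1 :=
  rfl

@[simp]
theorem Tree.size_cons (a b : Tree) : (Tree.cons a b).size = a.size + b.size + 1 := by
  simp [Tree.size, Tree.word]

theorem Tree.size_pos : ∀ t : Tree, 0 < t.size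
  | .nil => by simp
  | .cons a b => by simp

theorem Tree.mem_word {t : Tree} {a : Γ'} (h : a ∈ t.word) : ∃ b, a = .bit b := by
  induction t with
  | nil => exact ⟨_, List.mem_singleton.1 h⟩
  | cons t u iht ihu =>
    simp only [Tree.word, List.mem_cons, List.mem_append] at h
    rcases h with h | h | h
    exacts [⟨_, h⟩, iht h, ihu h]

/-- The test whether the last symbol is `1`. -/
def isOne (v : Option Γ') : Bool :=
  decide (v = some (.bit true))

/-- The test whether the last symbol is not the end marker. -/
def notEnd (v : Option Γ') : Bool :=
  decide (v ≠ some .comma)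

/-- Push a symbol on those of the stacks `W` and `Z` that are marked. -/
def pushTo (w z : Bool) (a : Γ') : Cmd :=
  (bif w then .push .W a else .skip) ;; (bif z then .push .Z a else .skip)

/-- Remove the symbols of a tree from the main stack, where `C` holds a symbol for each pending
tree. -/
def takeLoop (w z : Bool) : Cmd :=
  .loop notEnd (.pop .V ;; .ite isOne (pushTo w z (.bit true) ;; .push .C .bra)
    (pushTo w z (.bit false) ;; .pop .C))

/-- Move a tree from the main stack to those of the stacks `W` and `Z` that are marked. -/
def take (w z : Bool) : Cmd :=
  .push .C .comma ;; .push .C .bra ;; .pop .C ;; takeLoop w z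

theorem Runs.pushTo (w z : Bool) (a : Γ') (v : Option Γ') (I V W Z C : List Γ') :
    Runs (pushTo w z a) ⟨v, I, V, W, Z, C⟩
      ⟨v, I, V, bif w then a :: W else W, bif z then a :: Z else Z, C⟩ 2 := by
  cases w <;> cases z
  · exact (Runs.skip _).seq (Runs.skip _)
  · exact (Runs.skip _).seq (Runs.push _ _ _)
  · exact (Runs.push _ _ _).seq (Runs.skip _)
  · exact (Runs.push _ _ _).seq (Runs.push _ _ _)

/-- A bit `1` opens a node, so one pending tree becomes two and `C` gains a symbol; a bit `0`
completes a tree and pops `C` into the register, where the loop test reads it. The form with a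
continuation `s` lets the hypotheses for the two subtrees be chained. Each symbol costs six steps:
test, pop, branch, two for `pushTo`, and one on `C`. -/
theorem Runs.takeLoop {w z : Bool} {I : List Γ'} {s : State} (t : Tree) :
    ∀ {v : Option Γ'} {V W Z C : List Γ'} {x : Γ'} {n : ℕ}, notEnd v = true →
      Runs (takeLoop w z) ⟨some x, I, V, bif w then t.word.reverse ++ W else W,
        bif z then t.word.reverse ++ Z else Z, C⟩ s n →
      Runs (takeLoop w z) ⟨v, I, t.word ++ V, W, Z, x :: C⟩ s (n + 6 * t.size) := by
  induction t with
  | nil =>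
    intro v V W Z C x n hv h
    refine Runs.mono (Runs.loop_true (s₂ := ⟨some x, I, V, bif w then .bit false :: W else W,
      bif z then .bit false :: Z else Z, C⟩) hv (Runs.seq (Runs.pop _ _) (Runs.ite_false rfl
        (Runs.seq (Runs.pushTo _ _ _ _ _ _ _ _ _) (Runs.pop _ _)))) h) ?_
    simp only [Tree.size_nil]
    omega
  | cons t u iht ihu =>
    intro v V W Z C x n hv h
    rw [Tree.word, List.cons_append, List.append_assoc]
    refine Runs.mono (Runs.loop_true (s₂ := ⟨some (.bit true), I, t.word ++ (u.word ++ V),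
      bif w then .bit true :: W else W, bif z then .bit true :: Z else Z, .bra :: x :: C⟩)
      (m := n + 6 * u.size + 6 * t.size) hv
      (Runs.seq (Runs.pop _ _) (Runs.ite_true rfl
        (Runs.seq (Runs.pushTo _ _ _ _ _ _ _ _ _) (Runs.push _ _ _)))) ?_) ?_
    · refine iht rfl (ihu rfl ?_)
      convert h using 2
      · cases w <;> simp [Tree.word]
      · cases z <;> simp [Tree.word]
    · simp only [Tree.size_cons]
      omega

/-- The symbol `.bra` is pushed and popped at once only to load the register with something other
than the end marker. The `.comma` that stays on `C` is what the completed tree pops, and this ends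
the loop. -/
theorem Runs.take (w z : Bool) (t : Tree) (v : Option Γ') (I V W Z C : List Γ') :
    Runs (take w z) ⟨v, I, t.word ++ V, W, Z, C⟩
      ⟨some .comma, I, V, bif w then t.word.reverse ++ W else W,
        bif z then t.word.reverse ++ Z else Z, C⟩ (6 * t.size + 4) := by
  refine ((Runs.push _ _ _).seq ((Runs.push _ _ _).seq ((Runs.pop _ _).seq
    (Runs.takeLoop t (C := C) (x := .comma) (n := 1) rfl ?_)))).mono (by omega)
  exact Runs.loop_false rfl

/-- Move a word that ends with an end marker back to the main stack. -/
def pour (k : Stk) : Cmd :=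
  .pop k ;; .loop notEnd (.ite isOne (.push .V (.bit true)) (.push .V (.bit false)) ;; .pop k)

/-- Words of trees consist of bits, so the first `.comma` marks where the saved word ends. Saving
reverses a word, and pouring reverses it again. -/
theorem Runs.pour_W {l : List Γ'} (hl : ∀ a ∈ l, ∃ b, a = .bit b) (v : Option Γ')
    (I V W Z C : List Γ') :
    Runs (pour .W) ⟨v, I, V, l ++ .comma :: W, Z, C⟩ ⟨some .comma, I, l.reverse ++ V, W, Z, C⟩
      (4 * l.length + 2) := by
  refine Runs.mono (Runs.seq (m := 4 * l.length + 1) (Runs.pop _ _) ?_) (by omega)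
  induction l generalizing V v with
  | nil => exact Runs.loop_false rfl
  | cons a l ih =>
    obtain ⟨b, rfl⟩ := hl a List.mem_cons_self
    have h := ih (fun a ha => hl a (List.mem_cons_of_mem _ ha)) v (.bit b :: V)
    rw [List.reverse_cons, List.append_assoc]
    refine Runs.mono (Runs.loop_true rfl (Runs.seq (n := 2)
      (s₂ := ⟨some (.bit b), I, .bit b :: V, l ++ .comma :: W, Z, C⟩) ?_ (Runs.pop _ _)) h) ?_
    · cases b
      · exact Runs.ite_false rfl (Runs.push _ _ _)
      · exact Runs.ite_true rfl (Runs.push _ _ _)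
    · simp only [List.length_cons]
      omega

theorem Runs.pour_Z {l : List Γ'} (hl : ∀ a ∈ l, ∃ b, a = .bit b) (v : Option Γ')
    (I V W Z C : List Γ') :
    Runs (pour .Z) ⟨v, I, V, W, l ++ .comma :: Z, C⟩ ⟨some .comma, I, l.reverse ++ V, W, Z, C⟩
      (4 * l.length + 2) := by
  refine Runs.mono (Runs.seq (m := 4 * l.length + 1) (Runs.pop _ _) ?_) (by omega)
  induction l generalizing V v with
  | nil => exact Runs.loop_false rfl
  | cons a l ih =>
    obtain ⟨b, rfl⟩ := hl a List.mem_cons_self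
    have h := ih (fun a ha => hl a (List.mem_cons_of_mem _ ha)) v (.bit b :: V)
    rw [List.reverse_cons, List.append_assoc]
    refine Runs.mono (Runs.loop_true rfl (Runs.seq (n := 2)
      (s₂ := ⟨some (.bit b), I, .bit b :: V, W, l ++ .comma :: Z, C⟩) ?_ (Runs.pop _ _)) h) ?_
    · cases b
      · exact Runs.ite_false rfl (Runs.push _ _ _)
      · exact Runs.ite_true rfl (Runs.push _ _ _)
    · simp only [List.length_cons]
      omega

/-- Remove the top tree. -/
def drop : Cmd :=
  take false false

/-- Save the top tree on the stack `W`. -/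
def saveW : Cmd :=
  .push .W .comma ;; take true false

/-- Save the top tree on the stack `Z`. -/
def saveZ : Cmd :=
  .push .Z .comma ;; take false true

/-- Duplicate the top tree. -/
def dup : Cmd :=
  .push .W .comma ;; .push .Z .comma ;; take true true ;; pour .W ;; pour .Z

section

variable (t : Tree) (v : Option Γ') (I V W Z C : List Γ')

theorem Runs.drop :
    Runs drop ⟨v, I, t.word ++ V, W, Z, C⟩ ⟨some .comma, I, V, W, Z, C⟩ (20 * t.size) :=
  (Runs.take false false t v I V W Z C).mono (by have := t.size_pos; omega)

theorem Runs.saveW :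
    Runs saveW ⟨v, I, t.word ++ V, W, Z, C⟩
      ⟨some .comma, I, V, t.word.reverse ++ .comma :: W, Z, C⟩ (20 * t.size) :=
  ((Runs.push _ _ _).seq (Runs.take true false t v I V (.comma :: W) Z C)).mono
    (by have := t.size_pos; omega)

theorem Runs.saveZ :
    Runs saveZ ⟨v, I, t.word ++ V, W, Z, C⟩
      ⟨some .comma, I, V, W, t.word.reverse ++ .comma :: Z, C⟩ (20 * t.size) :=
  ((Runs.push _ _ _).seq (Runs.take false true t v I V W (.comma :: Z) C)).mono
    (by have := t.size_pos; omega)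

theorem Runs.restoreW :
    Runs (pour .W) ⟨v, I, V, t.word.reverse ++ .comma :: W, Z, C⟩
      ⟨some .comma, I, t.word ++ V, W, Z, C⟩ (20 * t.size) := by
  have h := Runs.pour_W (l := t.word.reverse) (fun a ha => Tree.mem_word (List.mem_reverse.1 ha))
    v I V W Z C
  rw [List.reverse_reverse, List.length_reverse] at h
  exact h.mono (by have := t.size_pos; unfold Tree.size at *; omega)

theorem Runs.restoreZ :
    Runs (pour .Z) ⟨v, I, V, W, t.word.reverse ++ .comma :: Z, C⟩
      ⟨some .comma, I, t.word ++ V, W, Z, C⟩ (20 * t.size) := by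
  have h := Runs.pour_Z (l := t.word.reverse) (fun a ha => Tree.mem_word (List.mem_reverse.1 ha))
    v I V W Z C
  rw [List.reverse_reverse, List.length_reverse] at h
  exact h.mono (by have := t.size_pos; unfold Tree.size at *; omega)

theorem Runs.dup :
    Runs dup ⟨v, I, t.word ++ V, W, Z, C⟩ ⟨some .comma, I, t.word ++ (t.word ++ V), W, Z, C⟩
      (60 * t.size) :=
  ((Runs.push _ _ _).seq ((Runs.push _ _ _).seq
    ((Runs.take true true t v I V (.comma :: W) (.comma :: Z) C).seq
      ((Runs.restoreW t _ _ _ _ _ _).seq (Runs.restoreZ t _ _ _ _ _ _))))).mono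
    (by have := t.size_pos; omega)

end

end TreeMachine

/-! ### Codings by trees and functions computable in polynomial time. -/

namespace TreeMachine

/-- Types whose elements are written as trees. -/
class Code (α : Type) where
  tree : α → Tree

/-- The word of an element of a coded type. -/
def word {α : Type} [Code α] (a : α) : List Γ' :=
  (Code.tree a).word

/-- The size of an element of a coded type. -/
def sz {α : Type} [Code α] (a : α) : ℕ :=
  (Code.tree a).size

instance {α β : Type} [Code α] [Code β] : Code (α × β) :=
  ⟨fun p => .cons (Code.tree p.1) (Code.tree p.2)⟩

/-- The tree of a list. -/
def listTree {α : Type} [Code α] : List α → Tree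
  | [] => .nil
  | a :: l => .cons (Code.tree a) (listTree l)

instance {α : Type} [Code α] : Code (List α) :=
  ⟨listTree⟩

instance : Code Unit :=
  ⟨fun _ => .nil⟩

instance : Code Bool :=
  ⟨fun b => bif b then .cons .nil .nil else .nil⟩

instance {α : Type} [Code α] : Code (Option α) :=
  ⟨fun o => o.elim .nil fun a => .cons (Code.tree a) .nil⟩

/-- The tree of a natural number in unary notation. -/
def natTree : ℕ → Tree
  | 0 => .nil
  | n + 1 => .cons .nil (natTree n)

instance : Code ℕ :=
  ⟨natTree⟩

variable {α β γ δ : Type} [Code α] [Code β] [Code γ] [Code δ]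

theorem word_pair_append (a : α) (b : β) (V : List Γ') :
    word (a, b) ++ V = .bit true :: (word a ++ (word b ++ V)) := by
  simp [word, Code.tree, Tree.word]

theorem word_ne_nil (a : α) : word a ≠ [] := by
  unfold word
  cases Code.tree a <;> simp [Tree.word]

theorem Runs.pop_word {w : List Γ'} (hw : w ≠ []) (v : Option Γ') (I V W Z C : List Γ') :
    Runs (.pop .V) ⟨v, I, w ++ V, W, Z, C⟩ ⟨w.head?, I, w.tail ++ V, W, Z, C⟩ 1 := by
  cases w with
  | nil => exact absurd rfl hw
  | cons a w => exact Runs.pop .V _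

theorem sz_pos (a : α) : 0 < sz a :=
  Tree.size_pos _

@[simp]
theorem sz_pair (a : α) (b : β) : sz (a, b) = sz a + sz b + 1 :=
  Tree.size_cons _ _

@[simp]
theorem sz_nil : sz ([] : List α) = 1 :=
  rfl

@[simp]
theorem sz_cons (a : α) (l : List α) : sz (a :: l) = sz a + sz l + 1 :=
  Tree.size_cons _ _

@[simp]
theorem sz_none : sz (none : Option α) = 1 :=
  rfl

@[simp]
theorem sz_some (a : α) : sz (some a) = sz a + 2 := by
  simp [sz, Code.tree]

@[simp]
theorem sz_zero : sz 0 = 1 :=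
  rfl

@[simp]
theorem sz_nat (n : ℕ) : sz n = 2 * n + 1 := by
  induction n with
  | zero => rfl
  | succ n ih =>
    have : sz (n + 1) = 1 + sz n + 1 := Tree.size_cons _ _
    omega

theorem sz_bool (b : Bool) : sz b ≤ 3 := by
  cases b <;> simp [sz, Code.tree]

theorem length_le_sz (l : List α) : l.length ≤ sz l := by
  induction l with
  | nil => simp
  | cons a l ih =>
    simp only [List.length_cons, sz_cons]
    omega

theorem sz_le_of_mem {l : List α} {a : α} (h : a ∈ l) : sz a ≤ sz l := by
  induction l with
  | nil => simp at h
  | cons b l ih =>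
    rcases List.mem_cons.1 h with rfl | h
    · simp only [sz_cons]
      omega
    · have := ih h
      simp only [sz_cons]
      omega

theorem sz_list_le {l : List α} {B : ℕ} (h : ∀ a ∈ l, sz a ≤ B) :
    sz l ≤ l.length * (B + 1) + 1 := by
  induction l with
  | nil => simp
  | cons a l ih =>
    have h1 := ih fun b hb => h b (List.mem_cons_of_mem _ hb)
    have h2 := h a List.mem_cons_self
    simp only [sz_cons, List.length_cons, Nat.succ_mul]
    omega

theorem eval_mono (P : Polynomial ℕ) {n m : ℕ} (h : n ≤ m) : P.eval n ≤ P.eval m := by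
  induction P using Polynomial.induction_on' with
  | add p q hp hq => simpa using Nat.add_le_add hp hq
  | monomial k a => simpa using Nat.mul_le_mul_left a (Nat.pow_le_pow_left h k)

/-- Functions that are bounded by a polynomial in the size. -/
def PB (g : α → ℕ) : Prop :=
  ∃ P : Polynomial ℕ, ∀ x, g x ≤ P.eval (sz x)

namespace PB

theorem mono {g h : α → ℕ} (hh : PB h) (hg : ∀ x, g x ≤ h x) : PB g :=
  let ⟨P, hP⟩ := hh
  ⟨P, fun x => (hg x).trans (hP x)⟩

theorem const (n : ℕ) : PB fun _ : α => n :=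
  ⟨.C n, fun _ => by simp⟩

theorem size : PB fun x : α => sz x :=
  ⟨.X, fun _ => by simp⟩

theorem add {g h : α → ℕ} (hg : PB g) (hh : PB h) : PB fun x => g x + h x :=
  let ⟨P, hP⟩ := hg
  let ⟨Q, hQ⟩ := hh
  ⟨P + Q, fun x => by simpa using Nat.add_le_add (hP x) (hQ x)⟩

theorem mul {g h : α → ℕ} (hg : PB g) (hh : PB h) : PB fun x => g x * h x :=
  let ⟨P, hP⟩ := hg
  let ⟨Q, hQ⟩ := hh
  ⟨P * Q, fun x => by simpa using Nat.mul_le_mul (hP x) (hQ x)⟩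

theorem eval (P : Polynomial ℕ) {g : α → ℕ} (hg : PB g) : PB fun x => P.eval (g x) :=
  let ⟨Q, hQ⟩ := hg
  ⟨P.comp Q, fun x => by simpa using eval_mono P (hQ x)⟩

theorem comp {g : β → ℕ} {f : α → β} (hg : PB g) (hf : PB fun x => sz (f x)) :
    PB fun x => g (f x) :=
  let ⟨P, hP⟩ := hg
  (eval P hf).mono fun x => hP (f x)

end PB

/-- Functions that are computed by a program in polynomial time. -/
def PT (f : α → β) : Prop :=
  ∃ (c : Cmd) (T : α → ℕ), PB T ∧ (PB fun a => sz (f a)) ∧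
    ∀ a v I V W Z C, ∃ v',
      Runs c ⟨v, I, word a ++ V, W, Z, C⟩ ⟨v', I, word (f a) ++ V, W, Z, C⟩ (T a)

namespace PT

theorem size {f : α → β} (hf : PT f) : PB fun a => sz (f a) :=
  let ⟨_, _, _, h, _⟩ := hf
  h

/-- A function that does not change the tree. -/
theorem of_tree_eq {f : α → β} (h : ∀ a, Code.tree (f a) = Code.tree a) : PT f := by
  refine ⟨.skip, fun _ => 1, .const 1, PB.size.mono fun a => ?_, fun a v I V W Z C => ⟨v, ?_⟩⟩
  · simp [sz, h]
  · simp only [word, h]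
    exact Runs.skip _

theorem id : PT fun a : α => a :=
  of_tree_eq fun _ => rfl

theorem comp {g : β → γ} {f : α → β} (hg : PT g) (hf : PT f) : PT fun a => g (f a) := by
  obtain ⟨c, T, hT, hs, h⟩ := hf
  obtain ⟨c', T', hT', hs', h'⟩ := hg
  refine ⟨c ;; c', fun a => T a + T' (f a), hT.add (hT'.comp hs), hs'.comp hs,
    fun a v I V W Z C => ?_⟩
  obtain ⟨v₁, h₁⟩ := h a v I V W Z C
  obtain ⟨v₂, h₂⟩ := h' (f a) v₁ I V W Z C
  exact ⟨v₂, h₁.seq h₂⟩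

/-- The program that replaces the top tree by a given tree. -/
def _root_.TreeMachine.pushTree : Tree → Cmd
  | .nil => .push .V (.bit false)
  | .cons a b => pushTree b ;; pushTree a ;; .push .V (.bit true)

theorem _root_.TreeMachine.Runs.pushTree (t : Tree) : ∀ (v : Option Γ') (I V W Z C : List Γ'),
    Runs (pushTree t) ⟨v, I, V, W, Z, C⟩ ⟨v, I, t.word ++ V, W, Z, C⟩ t.size := by
  induction t with
  | nil => exact fun v I V W Z C => Runs.push _ _ _
  | cons a b iha ihb =>
    intro v I V W Z C
    rw [Tree.word, List.cons_append, List.append_assoc]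
    refine Runs.mono (Runs.seq (ihb v I V W Z C) (Runs.seq (iha v I _ W Z C) (Runs.push _ _ _))) ?_
    rw [Tree.size_cons]
    omega

theorem const (b : β) : PT fun _ : α => b := by
  refine ⟨drop ;; pushTree (Code.tree b), fun a => 20 * sz a + sz b,
    ((PB.const 20).mul .size).add (.const _), .const _, fun a v I V W Z C => ⟨some .comma, ?_⟩⟩
  exact (Runs.drop _ _ _ _ _ _ _).seq (Runs.pushTree _ _ _ _ _ _ _)

theorem pair {f : α → β} {g : α → γ} (hf : PT f) (hg : PT g) : PT fun a => (f a, g a) := by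
  obtain ⟨c, T, hT, hs, h⟩ := hf
  obtain ⟨c', T', hT', hs', h'⟩ := hg
  refine ⟨dup ;; c ;; saveW ;; c' ;; pour .W ;; .push .V (.bit true),
    fun a => 60 * sz a + (T a + (20 * sz (f a) + (T' a + (20 * sz (f a) + 1)))),
    ((PB.const 60).mul .size).add (hT.add (((PB.const 20).mul hs).add
      (hT'.add (((PB.const 20).mul hs).add (.const 1))))),
    ((hs.add hs').add (.const 1)).mono fun a => by simp, fun a v I V W Z C => ?_⟩
  obtain ⟨v₁, h₁⟩ := h a (some .comma) I (word a ++ V) W Z C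
  obtain ⟨v₂, h₂⟩ := h' a (some .comma) I V ((word (f a)).reverse ++ .comma :: W) Z C
  refine ⟨some .comma, ?_⟩
  have h₃ := (Runs.dup (Code.tree a) v I V W Z C).seq (h₁.seq
    ((Runs.saveW (Code.tree (f a)) v₁ I (word a ++ V) W Z C).seq
      (h₂.seq ((Runs.restoreW (Code.tree (f a)) v₂ I (word (g a) ++ V) W Z C).seq
        (Runs.push .V (.bit true) _)))))
  rw [word_pair_append]
  exact h₃

theorem fst {f : α → β × γ} (hf : PT f) : PT fun a => (f a).1 := by
  refine comp (g := fun p : β × γ => p.1) ?_ hf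
  refine ⟨.pop .V ;; saveW ;; drop ;; pour .W,
    fun p => 1 + (20 * sz p.1 + (20 * sz p.2 + 20 * sz p.1)),
    ((PB.const 60).mul .size).mono fun p => ?_, PB.size.mono fun p => ?_,
    fun p v I V W Z C => ⟨some .comma, ?_⟩⟩
  · have : sz p = sz p.1 + sz p.2 + 1 := sz_pair p.1 p.2
    omega
  · have : sz p = sz p.1 + sz p.2 + 1 := sz_pair p.1 p.2
    beta_reduce
    omega
  · rw [← Prod.eta p, word_pair_append]
    exact (Runs.pop .V _).seq ((Runs.saveW (Code.tree p.1) _ I (word p.2 ++ V) W Z C).seq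
      ((Runs.drop (Code.tree p.2) _ _ _ _ _ _).seq (Runs.restoreW _ _ _ _ _ _ _)))

theorem snd {f : α → β × γ} (hf : PT f) : PT fun a => (f a).2 := by
  refine comp (g := fun p : β × γ => p.2) ?_ hf
  refine ⟨.pop .V ;; drop, fun p => 1 + 20 * sz p.1,
    ((PB.const 20).mul .size).mono fun p => ?_, PB.size.mono fun p => ?_,
    fun p v I V W Z C => ⟨some .comma, ?_⟩⟩
  · have : sz p = sz p.1 + sz p.2 + 1 := sz_pair p.1 p.2
    omega
  · have : sz p = sz p.1 + sz p.2 + 1 := sz_pair p.1 p.2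
    beta_reduce
    omega
  · rw [← Prod.eta p, word_pair_append]
    exact (Runs.pop .V _).seq (Runs.drop (Code.tree p.1) _ I (word p.2 ++ V) W Z C)

/-- Case distinction: whether a tree is a leaf. -/
theorem tree_cases {β₁ β₂ : Type} [Code β₁] [Code β₂] {h : α → δ} {f F : α → γ}
    {g : (β₁ × β₂) × α → γ} (hh : PT h) (hf : PT f) (hg : PT g)
    (hF : ∀ x, Code.tree (h x) = .nil ∧ F x = f x ∨
      ∃ a b, Code.tree (h x) = .cons (Code.tree a) (Code.tree b) ∧ F x = g ((a, b), x)) :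
    PT F := by
  obtain ⟨c₁, T₁, hT₁, hs₁, h₁⟩ := hh
  obtain ⟨c₂, T₂, hT₂, hs₂, h₂⟩ := hf
  obtain ⟨c₃, T₃, ⟨P, hP⟩, ⟨Q, hQ⟩, h₃⟩ := hg
  have hb : PB fun x => sz (h x) + sz x + 1 := (hs₁.add .size).add (.const 1)
  -- The popped bit tells leaf from node. After a leaf only `x` is left on top, ready for `f`. After
  -- a node the popped bit is written back, with one more `1` above it as the root of the pair `((a,
  -- b), x)`.
  refine ⟨dup ;; c₁ ;; .pop .V ;; .ite isOne (.push .V (.bit true) ;; .push .V (.bit true) ;; c₃) c₂,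
    fun x => 60 * sz x + (T₁ x + (1 + ((2 + P.eval (sz (h x) + sz x + 1)) + T₂ x + 1))),
    ((PB.const 60).mul .size).add (hT₁.add ((PB.const 1).add
      ((((PB.const 2).add (.eval P hb)).add hT₂).add (.const 1)))),
    (hs₂.add (.eval Q hb)).mono fun x => ?_, fun x v I V W Z C => ?_⟩
  · rcases hF x with ⟨hx, hx'⟩ | ⟨a, b, hx, hx'⟩
    · rw [hx']
      omega
    · rw [hx']
      refine ((hQ _).trans (eval_mono _ (le_of_eq ?_))).trans (Nat.le_add_left _ _)
      simp [sz, hx, Code.tree]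
  · obtain ⟨v₁, h₁⟩ := h₁ x (some .comma) I (word x ++ V) W Z C
    have h₀ := (Runs.dup (Code.tree x) v I V W Z C).seq (h₁.seq (Runs.pop .V _))
    rcases hF x with ⟨hx, hx'⟩ | ⟨a, b, hx, hx'⟩
    · obtain ⟨v₂, h₂⟩ := h₂ x (some (.bit false)) I V W Z C
      refine ⟨v₂, Runs.mono ((Runs.dup (Code.tree x) v I V W Z C).seq (h₁.seq
        ((Runs.pop .V _).seq (m := T₂ x + 1) ?_)))
        (by dsimp only [sz]; omega)⟩
      rw [hx', word, hx]
      exact Runs.ite_false rfl h₂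
    · obtain ⟨v₃, h₃⟩ := h₃ ((a, b), x) (some (.bit true)) I V W Z C
      refine ⟨v₃, Runs.mono ((Runs.dup (Code.tree x) v I V W Z C).seq (h₁.seq
        ((Runs.pop .V _).seq (m := (2 + P.eval (sz (h x) + sz x + 1)) + 1) ?_)))
        (by dsimp only [sz]; omega)⟩
      have he : word ((a, b), x) ++ V =
          .bit true :: .bit true :: (((Code.tree a).word ++ (Code.tree b).word) ++
            (word x ++ V)) := by
        simp [word, Code.tree, Tree.word]
      rw [he] at h₃
      rw [hx', word, hx]
      refine Runs.ite_true rfl (Runs.mono ((Runs.push _ _ _).seq ((Runs.push _ _ _).seq h₃)) ?_)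
      have := (hP ((a, b), x)).trans (eval_mono P (m := sz (h x) + sz x + 1)
        (le_of_eq (by simp [sz, hx, Code.tree])))
      omega

end PT

/-- The program that folds a list into a value, where `c` computes the step. -/
def foldCmd (c : Cmd) : Cmd :=
  .loop isOne (saveW ;; saveZ ;; pour .W ;; .push .V (.bit true) ;; c ;; pour .Z ;; .pop .V)

/-- Loop invariant: the first bit of the remaining list is in the register, the rest of its word is
on top of the main stack, and the accumulator lies beneath. A round saves the head and the tail,
puts the head back next to the accumulator, marks both as a pair for `c`, and brings the tail back.
The bound `B` is required on all prefixes because the cost of a round depends on the current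
accumulator. -/
theorem Runs.foldCmd {g : β × γ → γ} {c : Cmd} {T : β × γ → ℕ}
    (h : ∀ a v I V W Z C, ∃ v',
      Runs c ⟨v, I, word a ++ V, W, Z, C⟩ ⟨v', I, word (g a) ++ V, W, Z, C⟩ (T a))
    {I V W Z C : List Γ'} {A B K : ℕ} (l : List β) : ∀ s : γ, sz l ≤ A →
      (∀ l₁, l₁ <+: l → sz (l₁.foldl (fun s a => g (a, s)) s) ≤ B) →
      (∀ a s, sz a ≤ A → sz s ≤ B → T (a, s) ≤ K) →
      Runs (foldCmd c) ⟨(word l).head?, I, (word l).tail ++ (word s ++ V), W, Z, C⟩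
        ⟨some (.bit false), I, word (l.foldl (fun s a => g (a, s)) s) ++ V, W, Z, C⟩
        (l.length * (80 * A + K + 4) + 1) := by
  induction l with
  | nil =>
    intro s _ _ _
    unfold TreeMachine.foldCmd
    exact Runs.mono (Runs.loop_false rfl) (by simp)
  | cons a l ih =>
    intro s hA hB hT
    rw [sz_cons] at hA
    obtain ⟨v₁, h₁⟩ := h (a, s) (some .comma) I V W ((word l).reverse ++ .comma :: Z) C
    have h₂ := ih (g (a, s)) (by omega) (fun l₁ hl => by
      simpa using hB (a :: l₁) ((List.cons_prefix_cons).2 ⟨rfl, hl⟩)) hT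
    have hK := hT a s (by omega) (by simpa using hB [] (List.nil_prefix))
    have he : (word (a :: l)).tail ++ (word s ++ V) = word a ++ (word l ++ (word s ++ V)) := by
      simp [word, Code.tree, listTree, Tree.word]
    rw [word_pair_append] at h₁
    rw [he]
    refine Runs.mono (Runs.loop_true rfl (Runs.seq (Runs.saveW (Code.tree a) _ _ _ _ _ _)
      (Runs.seq (Runs.saveZ (Code.tree l) _ _ _ _ _ _)
        (Runs.seq (Runs.restoreW (Code.tree a) _ _ _ _ _ _)
          (Runs.seq (Runs.push _ _ _) (Runs.seq h₁
            (Runs.seq (Runs.restoreZ (Code.tree l) _ _ _ _ _ _)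
              (Runs.pop_word (word_ne_nil l) _ _ _ _ _ _))))))) (s₃ := ⟨some (.bit false), I,
                word (l.foldl (fun s a => g (a, s)) (g (a, s))) ++ V, W, Z, C⟩)
                (m := l.length * (80 * A + K + 4) + 1) h₂) ?_
    have h3 : (Code.tree a).size = sz a := rfl
    have h4 : (Code.tree l).size = sz l := rfl
    rw [h3, h4, List.length_cons, Nat.add_mul l.length 1, Nat.one_mul]
    omega

/-- The bound `B` on all intermediate results is essential: iterating a polynomial time step can
otherwise produce exponentially large values. -/
theorem PT.foldl {l : α → List β} {i : α → γ} {step : α → γ → β → γ} (hl : PT l) (hi : PT i)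
    (hs : PT fun p : α × γ × β => step p.1 p.2.1 p.2.2) {B : α → ℕ} (hB : PB B)
    (hb : ∀ x l₁, l₁ <+: l x → sz (l₁.foldl (step x) (i x)) ≤ B x) :
    PT fun x => (l x).foldl (step x) (i x) := by
  have hg : PT fun p : β × α × γ => (p.2.1, step p.2.1 p.2.2 p.1) :=
    (PT.fst (.snd .id)).pair (hs.comp ((PT.fst (.snd .id)).pair
      ((PT.snd (.snd .id)).pair (.fst .id))))
  have hh : PT fun x => (l x, x, i x) := hl.pair (PT.id.pair hi)
  -- The program for one round sees only the list element and the accumulator, so the parameter `x`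
  -- travels inside the accumulator and is projected away at the end.
  have key : ∀ x (l : List β) (s : γ),
      l.foldl (fun s a => (fun p : β × α × γ => (p.2.1, step p.2.1 p.2.2 p.1)) (a, s)) (x, s) =
        (x, l.foldl (step x) s) := by
    intro x l
    induction l with
    | nil => exact fun s => rfl
    | cons a l ih => exact fun s => ih _
  refine PT.snd (f := fun x => (x, (l x).foldl (step x) (i x))) ?_
  obtain ⟨c₁, T₁, hT₁, hs₁, h₁⟩ := hh
  obtain ⟨c, T, ⟨P, hP⟩, -, h⟩ := hg
  -- The first pop removes the root bit of the pair of list and accumulator, the second loads the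
  -- first bit of the list into the register.
  refine ⟨c₁ ;; .pop .V ;; .pop .V ;; foldCmd c, fun x => T₁ x + (1 + (1 +
    ((l x).length * (80 * sz (l x) + P.eval (sz (l x) + (sz x + B x + 1) + 1) + 4) + 1))),
    hT₁.add ((PB.const 1).add ((PB.const 1).add ((PB.mul (hl.size.mono fun x => length_le_sz _)
      ((((PB.const 80).mul hl.size).add (.eval P ((hl.size.add ((PB.size.add hB).add
        (.const 1))).add (.const 1)))).add (.const 4))).add (.const 1)))),
    ((PB.size.add hB).add (.const 1)).mono fun x => ?_, fun x v I V W Z C => ?_⟩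
  · rw [sz_pair]
    have := hb x _ (List.prefix_refl _)
    omega
  · obtain ⟨v₁, h₁⟩ := h₁ x v I V W Z C
    have h₂ := Runs.foldCmd h (I := I) (V := V) (W := W) (Z := Z) (C := C) (l x) (x, i x)
      (A := sz (l x)) (B := sz x + B x + 1) (K := P.eval (sz (l x) + (sz x + B x + 1) + 1)) le_rfl
      (fun l₁ hl => by
        have := hb x l₁ hl
        rw [key, sz_pair]
        omega)
      (fun a s ha hs => (hP _).trans (eval_mono P (by rw [sz_pair]; omega)))
    rw [key] at h₂
    rw [word_pair_append] at h₁
    exact ⟨_, h₁.seq ((Runs.pop .V _).seq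
      ((Runs.pop_word (word_ne_nil (l x)) _ _ _ _ _ _).seq h₂))⟩

end TreeMachine

/-! ### Closure properties of the polynomial time functions. -/

namespace TreeMachine

variable {α β γ δ : Type} [Code α] [Code β] [Code γ] [Code δ]

namespace PT

theorem congr {f g : α → β} (hf : PT f) (h : ∀ x, g x = f x) : PT g :=
  funext h ▸ hf

theorem comp₂ {f : α → β → γ} {g : δ → α} {h : δ → β} (hf : PT fun p : α × β => f p.1 p.2)
    (hg : PT g) (hh : PT h) : PT fun x => f (g x) (h x) :=
  comp (g := fun p : α × β => f p.1 p.2) hf (hg.pair hh)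

/-! ### Booleans -/

theorem cond {b : α → Bool} {f g : α → γ} (hb : PT b) (hf : PT f) (hg : PT g) :
    PT fun x => bif b x then f x else g x := by
  refine tree_cases (β₁ := Unit) (β₂ := Unit) (g := fun p => f p.2) hb hg (hf.comp (.snd .id))
    fun x => ?_
  cases h : b x
  · exact .inl ⟨rfl, rfl⟩
  · exact .inr ⟨(), (), rfl, rfl⟩

theorem not {b : α → Bool} (hb : PT b) : PT fun x => !b x :=
  (hb.cond (.const false) (.const true)).congr fun x => by cases b x <;> rfl

theorem and {b c : α → Bool} (hb : PT b) (hc : PT c) : PT fun x => b x && c x :=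
  (hb.cond hc (.const false)).congr fun x => by cases b x <;> rfl

theorem or {b c : α → Bool} (hb : PT b) (hc : PT c) : PT fun x => b x || c x :=
  (hb.cond (.const true) hc).congr fun x => by cases b x <;> rfl

/-! ### Options -/

theorem optionSome {f : α → β} (hf : PT f) : PT fun x => some (f x) :=
  comp (g := fun p : β × Unit => some p.1) (of_tree_eq fun _ => rfl) (hf.pair (.const ()))

theorem option_cases {o : α → Option β} {f F : α → γ} {g : β → α → γ} (ho : PT o) (hf : PT f)
    (hg : PT fun p : β × α => g p.1 p.2) (h₁ : ∀ x, o x = none → F x = f x)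
    (h₂ : ∀ x b, o x = some b → F x = g b x) : PT F := by
  refine tree_cases (β₁ := β) (β₂ := Unit) (g := fun p => g p.1.1 p.2) ho hf
    (hg.comp₂ (f := g) (.fst (.fst .id)) (.snd .id)) fun x => ?_
  cases h : o x with
  | none => exact .inl ⟨rfl, h₁ x h⟩
  | some b => exact .inr ⟨b, (), rfl, h₂ x b h⟩

/-! ### Lists -/

theorem cons {f : α → β} {l : α → List β} (hf : PT f) (hl : PT l) : PT fun x => f x :: l x :=
  comp (g := fun p : β × List β => p.1 :: p.2) (of_tree_eq fun _ => rfl) (hf.pair hl)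

theorem list_cases {l : α → List β} {f F : α → γ} {g : β → List β → α → γ} (hl : PT l) (hf : PT f)
    (hg : PT fun p : (β × List β) × α => g p.1.1 p.1.2 p.2) (h₁ : ∀ x, l x = [] → F x = f x)
    (h₂ : ∀ x b r, l x = b :: r → F x = g b r x) : PT F := by
  refine tree_cases hl hf hg fun x => ?_
  cases h : l x with
  | nil => exact .inl ⟨rfl, h₁ x h⟩
  | cons b r => exact .inr ⟨b, r, rfl, h₂ x b r h⟩

theorem isEmpty {l : α → List β} (hl : PT l) : PT fun x => (l x).isEmpty :=
  list_cases (g := fun _ _ _ => false) hl (.const true) (.const false) (fun x h => by simp [h])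
    fun x b r h => by simp [h]

theorem tail {l : α → List β} (hl : PT l) : PT fun x => (l x).tail :=
  list_cases (g := fun _ r _ => r) hl (.const []) (.snd (.fst .id)) (fun x h => by simp [h])
    fun x b r h => by simp [h]

theorem _root_.TreeMachine.sz_append (l₁ l₂ : List β) : sz (l₁ ++ l₂) + 1 = sz l₁ + sz l₂ := by
  induction l₁ with
  | nil => simp [Nat.add_comm]
  | cons a l ih =>
    simp only [List.cons_append, sz_cons]
    omega

theorem _root_.TreeMachine.sz_reverse (l : List β) : sz l.reverse = sz l := by
  induction l with
  | nil => rfl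
  | cons a l ih =>
    have := sz_append l.reverse [a]
    simp only [List.reverse_cons, sz_cons, sz_nil] at *
    omega

theorem reverse {l : α → List β} (hl : PT l) : PT fun x => (l x).reverse := by
  refine (foldl (step := fun _ s a => a :: s) (i := fun _ => []) hl (.const [])
    (.cons (.snd (.snd .id)) (.fst (.snd .id))) hl.size fun x l₁ h => ?_).congr fun x => by simp
  obtain ⟨t, ht⟩ := h
  have h1 := sz_append l₁ t
  have := sz_pos t
  simp only [List.foldl_flip_cons_eq_append', List.append_nil, sz_reverse]
  rw [ht] at h1
  omega

theorem foldr {l : α → List β} {i : α → γ} {step : α → β → γ → γ} (hl : PT l) (hi : PT i)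
    (hs : PT fun p : α × β × γ => step p.1 p.2.1 p.2.2) {B : α → ℕ} (hB : PB B)
    (hb : ∀ x l₁, l₁ <:+ l x → sz (l₁.foldr (step x) (i x)) ≤ B x) :
    PT fun x => (l x).foldr (step x) (i x) := by
  refine (foldl (step := fun x s a => step x a s) hl.reverse hi
    (hs.comp (f := fun p : α × γ × β => (p.1, p.2.2, p.2.1))
      ((PT.fst .id).pair ((PT.snd (.snd .id)).pair (.fst (.snd .id))))) hB fun x l₁ h => ?_).congr
    fun x => by simp
  have := hb x l₁.reverse (by rwa [← List.reverse_prefix, List.reverse_reverse])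
  simpa using this

theorem append {f g : α → List β} (hf : PT f) (hg : PT g) : PT fun x => f x ++ g x := by
  refine (foldr (step := fun _ a s => a :: s) hf hg (.cons (.fst (.snd .id)) (.snd (.snd .id)))
    (hf.size.add hg.size) fun x l₁ h => ?_).congr fun x => by simp
  obtain ⟨t, ht⟩ := h
  have h1 := sz_append t l₁
  have h2 := sz_append l₁ (g x)
  have := sz_pos t
  rw [ht] at h1
  simp only [List.foldr_cons_eq_append'] at *
  omega

/-- The fold concatenates at most `(l x).length` blocks, each bounded by the output polynomial `P`
of `g` at a size that covers every pair `(x, a)` with `a` in the list. -/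
theorem flatMap {l : α → List β} {g : α → β → List γ} (hl : PT l)
    (hg : PT fun p : α × β => g p.1 p.2) : PT fun x => (l x).flatMap (g x) := by
  obtain ⟨P, hP⟩ := hg.size
  refine (foldr (step := fun x a s => g x a ++ s) hl (.const [])
    (append (hg.comp₂ (.fst .id) (.fst (.snd .id))) (.snd (.snd .id)))
    (B := fun x => sz (l x) * P.eval (sz x + sz (l x) + 1) + 1)
    ((hl.size.mul (.eval P ((PB.size.add hl.size).add (.const 1)))).add (.const 1))
    fun x l₁ h => ?_).congr fun x => ?_
  · have h1 : ∀ l₁ : List β, (∀ a ∈ l₁, a ∈ l x) →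
        sz (l₁.foldr (fun a s => g x a ++ s) []) ≤
          l₁.length * P.eval (sz x + sz (l x) + 1) + 1 := by
      intro l₁
      induction l₁ with
      | nil => simp
      | cons a l₁ ih =>
        intro ha
        have h1 := ih fun b hb => ha b (List.mem_cons_of_mem _ hb)
        have h2 : sz (g x a) ≤ P.eval (sz x + sz (l x) + 1) := (hP (x, a)).trans (eval_mono P (by
          have := sz_le_of_mem (ha a List.mem_cons_self)
          rw [sz_pair]
          omega))
        have h3 := sz_append (g x a) (l₁.foldr (fun a s => g x a ++ s) [])
        rw [List.foldr_cons, List.length_cons, Nat.add_mul l₁.length 1, Nat.one_mul]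
        omega
    refine (h1 l₁ fun a ha => h.subset ha).trans ?_
    exact Nat.add_le_add_right (Nat.mul_le_mul_right _
      (h.length_le.trans (length_le_sz _))) 1
  · induction l x with
    | nil => rfl
    | cons a l ih => rw [List.flatMap_cons, ih, List.foldr_cons]

theorem map {l : α → List β} {g : α → β → γ} (hl : PT l) (hg : PT fun p : α × β => g p.1 p.2) :
    PT fun x => (l x).map (g x) :=
  (flatMap (g := fun x a => [g x a]) hl (.cons hg (.const []))).congr fun _ =>
    List.map_eq_flatMap

theorem filter {l : α → List β} {p : α → β → Bool} (hl : PT l)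
    (hp : PT fun q : α × β => p q.1 q.2) : PT fun x => (l x).filter (p x) := by
  refine (flatMap (g := fun x a => bif p x a then [a] else []) hl
    (.cond hp (.cons (.snd .id) (.const [])) (.const []))).congr fun x => ?_
  induction l x with
  | nil => rfl
  | cons a l ih =>
    rw [List.flatMap_cons, ← ih]
    cases h : p x a <;> simp [h]

theorem any {l : α → List β} {p : α → β → Bool} (hl : PT l)
    (hp : PT fun q : α × β => p q.1 q.2) : PT fun x => (l x).any (p x) := by
  refine (hl.filter hp).isEmpty.not.congr fun x => ?_
  induction l x with
  | nil => rfl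
  | cons a l ih => cases h : p x a <;> simp [h, ih]

/-- The function does not depend on the elements of the list, only on its length. -/
theorem length {l : α → List β} (hl : PT l) : PT fun x => (l x).length := by
  refine comp (g := fun l : List Unit => l.length) (f := fun x => (l x).map fun _ => ())
    (of_tree_eq fun l => ?_) (hl.map (.const ())) |>.congr fun x => by simp
  induction l with
  | nil => rfl
  | cons a l ih => exact congrArg (Tree.cons .nil) ih

/-! ### Natural numbers -/

theorem succ {n : α → ℕ} (hn : PT n) : PT fun x => n x + 1 :=
  comp (g := fun p : Unit × ℕ => p.2 + 1) (of_tree_eq fun _ => rfl) ((PT.const ()).pair hn)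

theorem units {n : α → ℕ} (hn : PT n) : PT fun x => List.replicate (n x) () := by
  refine comp (g := fun n : ℕ => List.replicate n ()) (of_tree_eq fun n => ?_) hn
  induction n with
  | zero => rfl
  | succ n ih => exact congrArg (Tree.cons .nil) ih

/-- Numbers are unary, so subtraction drops one element of the first list for each element of the
second; truncation comes from `[].tail = []`. -/
theorem sub {m n : α → ℕ} (hm : PT m) (hn : PT n) : PT fun x => m x - n x := by
  refine ((hm.units.pair hn.units).snd.foldl (step := fun _ s _ => s.tail) hm.units
    (.tail (.fst (.snd .id))) hm.units.size fun x l₁ h => ?_).length.congr fun x => ?_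
  · clear h
    generalize List.replicate (m x) () = l
    induction l₁ generalizing l with
    | nil => exact le_rfl
    | cons a l₁ ih =>
      refine (ih l.tail).trans ?_
      cases l
      · exact le_rfl
      · simp only [List.tail_cons, sz_cons]
        omega
  · generalize hl : List.replicate (m x) () = l
    have : m x = l.length := by simp [← hl]
    rw [this]
    generalize n x = k
    clear hl this
    induction k generalizing l with
    | zero => rfl
    | succ k ih =>
      rw [List.replicate_succ, List.foldl_cons, ← ih, List.length_tail]
      omega

theorem lt {m n : α → ℕ} (hm : PT m) (hn : PT n) : PT fun x => decide (m x < n x) := by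
  refine ((hn.sub hm).units.isEmpty.not).congr fun x => ?_
  by_cases h : m x < n x
  · simp [h]
    omega
  · simp [h]
    omega

/-! ### Words -/

/-- A numbering of the symbols. -/
def _root_.TreeMachine.symbolIndex : Γ' → ℕ
  | .blank => 0
  | .bit false => 1
  | .bit true => 2
  | .bra => 3
  | .ket => 4
  | .comma => 5

instance _root_.TreeMachine.instCodeSymbol : Code Γ' :=
  ⟨fun a => Code.tree (symbolIndex a)⟩

/-- The numbering of the symbols is injective, so equality means that neither index is less than the
other. -/
theorem symbol_eq {f g : α → Γ'} (hf : PT f) (hg : PT g) : PT fun x => decide (f x = g x) := by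
  have h : PT symbolIndex := of_tree_eq fun _ => rfl
  refine (((h.comp hf).lt (h.comp hg)).not.and ((h.comp hg).lt (h.comp hf)).not).congr
    fun x => ?_
  generalize f x = a
  generalize g x = b
  rcases a with _ | (_ | _) | _ | _ | _ <;> rcases b with _ | (_ | _) | _ | _ | _ <;> rfl

/-- Compare the next symbol of two words, where the first component is the rest of one of them,
and the second one tells whether the words agree so far. -/
def _root_.TreeMachine.compareNext (a : Γ') : List Γ' × Bool → List Γ' × Bool
  | ([], _) => ([], false)
  | (b :: r, ok) => (r, ok && decide (a = b))

theorem word_eq {f g : α → List Γ'} (hf : PT f) (hg : PT g) : PT fun x => decide (f x = g x) := by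
  have hs : PT fun p : α × (List Γ' × Bool) × Γ' => compareNext p.2.2 p.2.1 := by
    refine list_cases (f := fun _ => ([], false))
      (g := fun b r p => (r, p.2.1.2 && decide (p.2.2 = b))) (.fst (.fst (.snd .id)))
      (.const _) (.pair (.snd (.fst .id)) (.and (.snd (.fst (.snd (.snd .id))))
        (.symbol_eq (.snd (.snd (.snd .id))) (.fst (.fst .id))))) ?_ ?_
    · rintro ⟨x, ⟨l, ok⟩, a⟩ (h : l = [])
      rw [h]
      rfl
    · rintro ⟨x, ⟨l, ok⟩, a⟩ b r (h : l = b :: r)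
      rw [h]
      rfl
  have h := foldl (step := fun _ s a => compareNext a s) (i := fun x => (g x, true)) hf
    (hg.pair (.const true)) hs (B := fun x => sz (g x) + 4) (hg.size.add (.const 4))
    fun x l₁ hl => ?_
  · refine (h.snd.and h.fst.isEmpty).congr fun x => ?_
    -- Two words are equal if the flag survives the scan and nothing of the second word is left
    -- over. A second word that is too short clears the flag.
    have key : ∀ (l r : List Γ') (ok : Bool),
        ((l.foldl (fun s a => compareNext a s) (r, ok)).2 &&
          (l.foldl (fun s a => compareNext a s) (r, ok)).1.isEmpty) = (ok && decide (l = r)) := by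
      intro l
      induction l with
      | nil => rintro (_ | ⟨b, r⟩) ok <;> simp
      | cons a l ih =>
        rintro (_ | ⟨b, r⟩) ok
        · refine (ih [] false).trans ?_
          simp
        · refine (ih r (ok && decide (a = b))).trans ?_
          by_cases h : a = b <;> by_cases h' : l = r <;> simp [h, h']
    simpa using (key (f x) (g x) true).symm
  · clear hl
    generalize true = ok
    generalize g x = r
    induction l₁ generalizing r ok with
    | nil =>
      have := sz_bool ok
      simp only [List.foldl_nil, sz_pair]
      omega
    | cons a l ih =>
      rcases r with _ | ⟨b, r⟩
      · exact ih _ _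
      · refine (ih (ok && decide (a = b)) r).trans ?_
        simp only [sz_cons]
        omega

end PT

end TreeMachine

/-! ### An auction algorithm for matchings -/

namespace Auction

variable {τ C : Type*}

/-- The list of cells can be matched into the list of tuples. -/
def Matchable (adj : C → τ → Bool) (cells : List C) (T : List τ) : Prop :=
  ∃ P : List (C × τ), (P.map Prod.fst).Perm cells ∧ (P.map Prod.snd).Subperm T ∧
    ∀ p ∈ P, adj p.1 p.2 = true

/-- One step of the search for the cheapest slot that is adjacent to a cell. A slot consists of a
tuple, its price, and its owner; the first component of the state collects the other slots. -/
def pickStep (adj : τ → Bool) (s : List (τ × ℕ × Option C) × Option (τ × ℕ × Option C))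
    (x : τ × ℕ × Option C) : List (τ × ℕ × Option C) × Option (τ × ℕ × Option C) :=
  match s with
  | (seen, none) => bif adj x.1 then (seen, some x) else (x :: seen, none)
  | (seen, some b) =>
    bif adj x.1 && decide (x.2.1 < b.2.1) then (b :: seen, some x) else (x :: seen, some b)

/-- The cheapest slot that satisfies `adj`, together with the other slots. -/
def pick (adj : τ → Bool) (slots : List (τ × ℕ × Option C)) :
    List (τ × ℕ × Option C) × Option (τ × ℕ × Option C) :=
  slots.foldl (pickStep adj) ([], none)

/-- The result of a bid of the cell `c`, given the remaining cells and the result of the search. -/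
def bid (N : ℕ) (c : C) (Q : List C) (st : List (τ × ℕ × Option C) × List C)
    (r : List (τ × ℕ × Option C) × Option (τ × ℕ × Option C)) :
    List (τ × ℕ × Option C) × List C :=
  match r.2 with
  | none => st
  | some b =>
    bif decide (b.2.1 < N) then ((b.1, b.2.1 + 1, some c) :: r.1, b.2.2.toList ++ Q) else st

/-- One step of the auction: the first unmatched cell bids for a slot. -/
def step (adj : C → τ → Bool) (N : ℕ) (st : List (τ × ℕ × Option C) × List C) :
    List (τ × ℕ × Option C) × List C :=
  match st.2 with
  | [] => st
  | c :: Q => bid N c Q st (pick (adj c) st.1)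

/-- Induction from the right end of the list follows the left fold: each new slot either replaces
the current best, which joins the others, or joins them itself. -/
theorem pick_spec (adj : τ → Bool) (slots : List (τ × ℕ × Option C)) :
    ((pick adj slots).2.toList ++ (pick adj slots).1).Perm slots ∧
    (∀ b ∈ (pick adj slots).2, adj b.1 = true) ∧
    ∀ x ∈ slots, adj x.1 = true → ∃ b ∈ (pick adj slots).2, b.2.1 ≤ x.2.1 := by
  induction slots using List.reverseRecOn with
  | nil => simp [pick]
  | append_singleton l x ih =>
    have h : pick adj (l ++ [x]) = pickStep adj (pick adj l) x := by simp [pick]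
    rw [h]
    obtain ⟨h₁, h₂, h₃⟩ := ih
    generalize pick adj l = s at *
    obtain ⟨seen, _ | b⟩ := s
    · simp only [Option.toList_none, List.nil_append, Option.mem_def, reduceCtorEq,
        false_and, exists_false, imp_false] at *
      have hp : (x :: seen).Perm (l ++ [x]) :=
        (h₁.cons x).trans (List.perm_append_singleton x l).symm
      cases hx : adj x.1
      · simp only [pickStep, hx, cond_false, Option.toList_none, List.nil_append]
        refine ⟨hp, by simp, fun y hy h => ?_⟩
        rcases List.mem_append.1 hy with hy | hy
        · exact absurd h (h₃ y hy)
        · rw [List.mem_singleton.1 hy, hx] at h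
          exact absurd h (by simp)
      · simp only [pickStep, hx, cond_true, Option.toList_some, List.singleton_append]
        refine ⟨hp, by simp [hx], fun y hy h => ⟨x, rfl, ?_⟩⟩
        rcases List.mem_append.1 hy with hy | hy
        · exact absurd h (h₃ y hy)
        · rw [List.mem_singleton.1 hy]
    · simp only [Option.toList_some, List.singleton_append, Option.mem_def, Option.some.injEq,
        forall_eq', exists_eq_left'] at *
      have hp : (x :: b :: seen).Perm (l ++ [x]) :=
        (h₁.cons x).trans (List.perm_append_singleton x l).symm
      cases hx : adj x.1 && decide (x.2.1 < b.2.1)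
      · simp only [pickStep, hx, cond_false, Option.toList_some, List.singleton_append,
          Option.some.injEq, forall_eq', exists_eq_left']
        refine ⟨(List.Perm.swap x b seen).trans hp, h₂, fun y hy h => ?_⟩
        rcases List.mem_append.1 hy with hy | hy
        · exact h₃ y hy h
        · rw [List.mem_singleton.1 hy] at h ⊢
          simpa [h] using hx
      · simp only [pickStep, hx, cond_true, Option.toList_some, List.singleton_append,
          Option.some.injEq, forall_eq', exists_eq_left']
        simp only [Bool.and_eq_true, decide_eq_true_eq] at hx
        refine ⟨hp, hx.1, fun y hy h => ?_⟩
        rcases List.mem_append.1 hy with hy | hy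
        · exact hx.2.le.trans (h₃ y hy h)
        · rw [List.mem_singleton.1 hy]

/-- The invariants of the auction. -/
structure Inv (adj : C → τ → Bool) (N : ℕ) (cells : List C) (T : List τ)
    (st : List (τ × ℕ × Option C) × List C) : Prop where
  tuples : (st.1.map Prod.fst).Perm T
  owners : (st.1.filterMap (fun x => x.2.2) ++ st.2).Perm cells
  price_zero : ∀ x ∈ st.1, x.2.2 = none → x.2.1 = 0
  adj_owner : ∀ x ∈ st.1, ∀ c ∈ x.2.2, adj c x.1 = true
  slack : ∀ x ∈ st.1, ∀ c ∈ x.2.2, ∀ y ∈ st.1, adj c y.1 = true → x.2.1 ≤ y.2.1 + 1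
  price_le : ∀ x ∈ st.1, x.2.1 ≤ N

/-- The initial state of the auction. -/
def init (cells : List C) (T : List τ) : List (τ × ℕ × Option C) × List C :=
  (T.map fun t => (t, 0, none), cells)

theorem inv_init (adj : C → τ → Bool) (N : ℕ) (cells : List C) (T : List τ) :
    Inv adj N cells T (init cells T) where
  tuples := by simp [init, Function.comp_def]
  owners := by
    have : (T.map fun t => ((t, 0, none) : τ × ℕ × Option C)).filterMap (fun x => x.2.2) = [] := by
      simp
    simp [init, this]
  price_zero := by simp [init]
  adj_owner := by simp [init]
  slack := by simp [init]
  price_le := by simp [init]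

/-- The sum of the prices. -/
def total (st : List (τ × ℕ × Option C) × List C) : ℕ :=
  (st.1.map fun x => x.2.1).sum

/-- The dichotomy used throughout: a step without effect comes with its reason, an empty queue or a
cell whose adjacent slots have all reached the price cap; any other step is a genuine bid at the
minimal price. -/
theorem step_cases (adj : C → τ → Bool) (N : ℕ) (st : List (τ × ℕ × Option C) × List C) :
    (step adj N st = st ∧ (st.2 = [] ∨ ∃ c ∈ st.2, ∀ x ∈ st.1, adj c x.1 = true → N ≤ x.2.1)) ∨
    ∃ c Q b seen, st.2 = c :: Q ∧ (b :: seen).Perm st.1 ∧ adj c b.1 = true ∧ b.2.1 < N ∧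
      (∀ x ∈ st.1, adj c x.1 = true → b.2.1 ≤ x.2.1) ∧
      step adj N st = ((b.1, b.2.1 + 1, some c) :: seen, b.2.2.toList ++ Q) := by
  obtain ⟨slots, _ | ⟨c, Q⟩⟩ := st
  · exact .inl ⟨rfl, .inl rfl⟩
  · obtain ⟨h₁, h₂, h₃⟩ := pick_spec (adj c) slots
    have hs : step adj N (slots, c :: Q) = bid N c Q (slots, c :: Q) (pick (adj c) slots) := rfl
    rw [hs]
    generalize pick (adj c) slots = r at *
    obtain ⟨seen, _ | b⟩ := r
    · refine .inl ⟨rfl, .inr ⟨c, List.mem_cons_self, fun x hx h => ?_⟩⟩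
      obtain ⟨b, hb, -⟩ := h₃ x hx h
      simp at hb
    · simp only [Option.toList_some, List.singleton_append, Option.mem_def, Option.some.injEq,
        forall_eq', exists_eq_left'] at *
      by_cases h : b.2.1 < N
      · exact .inr ⟨c, Q, b, seen, rfl, h₁, h₂, h, h₃, by simp [bid, h]⟩
      · refine .inl ⟨by simp [bid, h], .inr ⟨c, List.mem_cons_self, fun x hx hx' => ?_⟩⟩
        exact (not_lt.1 h).trans (h₃ x hx hx')

/-- The point is `slack`. A new owner bid on a cheapest adjacent slot, so the raised price exceeds
no adjacent price by more than one; for the other owners the inequality can only improve, as prices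
never fall. Unowned slots keep price 0 because a slot that has received a bid always retains some
owner. -/
theorem Inv.step {adj : C → τ → Bool} {N : ℕ} {cells : List C} {T : List τ}
    {st : List (τ × ℕ × Option C) × List C} (h : Inv adj N cells T st) :
    Inv adj N cells T (step adj N st) := by
  rcases step_cases adj N st with ⟨hs, -⟩ | ⟨c, Q, b, seen, hst, hp, hb, hN, hmin, hs⟩
  · rwa [hs]
  · rw [hs]
    have hmem : ∀ x ∈ seen, x ∈ st.1 := fun x hx => hp.subset (List.mem_cons_of_mem _ hx)
    have hbm : b ∈ st.1 := hp.subset List.mem_cons_self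
    refine ⟨?_, ?_, ?_, ?_, ?_, ?_⟩
    · exact (hp.map Prod.fst).trans h.tuples
    · refine List.Perm.trans ?_ h.owners
      have h1 := (hp.filterMap (fun x : τ × ℕ × Option C => x.2.2)).append_right st.2
      refine List.Perm.trans ?_ h1
      rw [hst, ← Multiset.coe_eq_coe]
      rcases hbo : b.2.2 with _ | d
      · simp only [List.filterMap_cons, hbo, Option.toList_none, List.nil_append,
          List.cons_append, Multiset.coe_eq_coe]
        exact List.perm_middle.symm
      · simp only [List.filterMap_cons, hbo, Option.toList_some, List.cons_append,
          List.nil_append, Multiset.coe_eq_coe]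
        refine (List.Perm.cons _ List.perm_middle).trans ?_
        refine (List.Perm.swap _ _ _).trans ?_
        exact (List.Perm.cons _ List.perm_middle.symm)
    · simp only [List.forall_mem_cons, reduceCtorEq, false_imp_iff, true_and]
      exact fun x hx => h.price_zero x (hmem x hx)
    · simp only [List.forall_mem_cons, Option.mem_def, Option.some.injEq, forall_eq']
      exact ⟨hb, fun x hx => h.adj_owner x (hmem x hx)⟩
    · simp only [List.forall_mem_cons, Option.mem_def, Option.some.injEq, forall_eq']
      refine ⟨⟨fun _ => by omega, fun y hy hy' => ?_⟩, fun x hx d hd => ⟨fun hd' => ?_, ?_⟩⟩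
      · have := hmin y (hmem y hy) hy'
        omega
      · have := h.slack x (hmem x hx) d hd b hbm hd'
        omega
      · exact fun y hy hy' => h.slack x (hmem x hx) d hd y (hmem y hy) hy'
    · simp only [List.forall_mem_cons]
      exact ⟨hN, fun x hx => h.price_le x (hmem x hx)⟩

theorem Inv.iterate {adj : C → τ → Bool} {N : ℕ} {cells : List C} {T : List τ}
    {st : List (τ × ℕ × Option C) × List C} (h : Inv adj N cells T st) (k : ℕ) :
    Inv adj N cells T ((Auction.step adj N)^[k] st) := by
  induction k with
  | zero => exact h
  | succ k ih =>
    rw [Function.iterate_succ_apply']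
    exact ih.step

/-- Every effective bid raises the sum of the prices by exactly one, and a stationary state stays
stationary. -/
theorem le_total_iterate (adj : C → τ → Bool) (N : ℕ) (st : List (τ × ℕ × Option C) × List C)
    (k : ℕ) : k ≤ total ((step adj N)^[k] st) ∨
      step adj N ((step adj N)^[k] st) = (step adj N)^[k] st := by
  induction k with
  | zero => exact .inl (Nat.zero_le _)
  | succ k ih =>
    rw [Function.iterate_succ_apply']
    generalize (step adj N)^[k] st = s at *
    by_cases hfix : step adj N s = s
    · right
      rw [hfix, hfix]
    · left
      rcases step_cases adj N s with ⟨hs, -⟩ | ⟨c, Q, b, seen, -, hp, -, -, -, hs⟩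
      · exact absurd hs hfix
      · have h1 := (hp.map fun x => x.2.1).sum_eq
        have h2 := ih.resolve_right hfix
        simp only [total, hs, List.map_cons, List.sum_cons] at *
        omega

theorem Inv.length_eq {adj : C → τ → Bool} {N : ℕ} {cells : List C} {T : List τ}
    {st : List (τ × ℕ × Option C) × List C} (h : Inv adj N cells T st) :
    st.1.length = T.length := by
  simpa using h.tuples.length_eq

theorem Inv.total_le {adj : C → τ → Bool} {N : ℕ} {cells : List C} {T : List τ}
    {st : List (τ × ℕ × Option C) × List C} (h : Inv adj N cells T st) :
    total st ≤ T.length * N := by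
  have h1 := List.sum_le_card_nsmul (st.1.map fun x => x.2.1) N fun y hy => by
    obtain ⟨x, hx, rfl⟩ := List.mem_map.1 hy
    exact h.price_le x hx
  simpa [total, h.length_eq] using h1

theorem Inv.matchable {adj : C → τ → Bool} {N : ℕ} {cells : List C} {T : List τ}
    {st : List (τ × ℕ × Option C) × List C} (h : Inv adj N cells T st) (hq : st.2 = []) :
    Matchable adj cells T := by
  refine ⟨st.1.filterMap fun x => x.2.2.map fun c => (c, x.1), ?_, ?_, ?_⟩
  · have h1 := h.owners
    rw [hq, List.append_nil] at h1
    rw [List.map_filterMap]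
    simpa [Function.comp_def] using h1
  · refine List.Subperm.trans (List.Sublist.subperm ?_) h.tuples.subperm
    rw [List.map_filterMap, ← List.filterMap_eq_map]
    generalize st.1 = l
    induction l with
    | nil => simp
    | cons x l ih => rcases hx : x.2.2 with _ | c <;> simp_all
  · intro p hp
    obtain ⟨x, hx, hxp⟩ := List.mem_filterMap.1 hp
    obtain ⟨c, hc, rfl⟩ := Option.map_eq_some_iff.1 hxp
    exact h.adj_owner x hx c hc

theorem length_filterMap_of_forall_ne_none {α β : Type*} {f : α → Option β} {l : List α}
    (h : ∀ x ∈ l, f x ≠ none) : (l.filterMap f).length = l.length := by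
  induction l with
  | nil => rfl
  | cons a l ih =>
    have h1 := ih fun x hx => h x (List.mem_cons_of_mem _ hx)
    rcases ha : f a with _ | b
    · exact absurd ha (h a List.mem_cons_self)
    · simp [ha, h1]

/-- Hall's condition fails for the set `D` of the stuck cell and the owners of all slots `S` priced
above a gap `k`: it has `|S| + 1` distinct cells, but all its neighbours lie in `S`. -/
theorem Inv.not_matchable {adj : C → τ → Bool} {N : ℕ} {cells : List C} {T : List τ}
    {st : List (τ × ℕ × Option C) × List C} (h : Inv adj N cells T st) (hcells : cells.Nodup)
    (hN : T.length < N) {c : C} (hc : c ∈ st.2)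
    (hstuck : ∀ x ∈ st.1, adj c x.1 = true → N ≤ x.2.1) : ¬ Matchable adj cells T := by
  classical
  rintro ⟨P, hP₁, hP₂, hP₃⟩
  -- There are at most `|T|` different prices but `|T| + 1` numbers from 0 to `|T|`.
  obtain ⟨k, hk, hk'⟩ : ∃ k ∈ Finset.range (T.length + 1),
      k ∉ (st.1.map fun x => x.2.1).toFinset := by
    refine Finset.exists_mem_notMem_of_card_lt_card ?_
    refine (List.toFinset_card_le _).trans_lt ?_
    simp [h.length_eq]
  simp only [Finset.mem_range, List.mem_toFinset, List.mem_map, not_exists, not_and] at hk hk'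
  set S := st.1.filter fun x => decide (k < x.2.1) with hS
  have hSm : ∀ x ∈ S, x ∈ st.1 ∧ k < x.2.1 := fun x hx => by simpa [hS] using hx
  set D := S.filterMap (fun x => x.2.2) ++ [c] with hD
  -- Slots in `S` have positive price and are therefore owned.
  have hDlen : D.length = S.length + 1 := by
    rw [hD, List.length_append, length_filterMap_of_forall_ne_none fun x hx hx' => ?_]
    · rfl
    · have := h.price_zero x (hSm x hx).1 hx'
      have := (hSm x hx).2
      omega
  have hDsub : D.Subperm cells := by
    refine List.Subperm.trans (List.Sublist.subperm ?_) h.owners.subperm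
    exact (List.Sublist.filterMap _ List.filter_sublist).append (List.singleton_sublist.2 hc)
  have hDnodup : D.Nodup := by
    obtain ⟨l, hl, hl'⟩ := hDsub
    exact hl.nodup_iff.1 (hl'.nodup hcells)
  -- For an owner, `slack` gives a price of at least `k` on adjacent slots, and the gap excludes `k`
  -- itself. For the stuck cell the adjacent prices are at least `N > |T| ≥ k`.
  have hDadj : ∀ d ∈ D, ∀ x ∈ st.1, adj d x.1 = true → k < x.2.1 := by
    intro d hd x hx hdx
    rcases List.mem_append.1 hd with hd | hd
    · obtain ⟨y, hy, hyd⟩ := List.mem_filterMap.1 hd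
      have h1 := h.slack y (hSm y hy).1 d hyd x hx hdx
      have h2 := (hSm y hy).2
      have h3 := hk' x hx
      omega
    · rw [List.mem_singleton.1 hd] at hdx
      have := hstuck x hx hdx
      omega
  set P' := P.filter fun p => decide (p.1 ∈ D) with hP'
  have hlen : D.length ≤ P'.length := by
    have h1 : D.Subperm (P'.map Prod.fst) := by
      refine List.subperm_of_subset hDnodup fun d hd => ?_
      obtain ⟨p, hp, rfl⟩ := List.mem_map.1 (hP₁.symm.subset (hDsub.subset hd))
      exact List.mem_map.2 ⟨p, by simp [hP', hp, hd], rfl⟩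
    simpa using h1.length_le
  -- A matching refers to tuples, not to slots, and equal tuples may occupy several slots at
  -- different prices. Hence `q` asks that all slots carrying the tuple lie above the gap, which
  -- does hold for neighbours of `D`.
  let q : τ → Bool := fun t => decide (∀ x ∈ st.1, x.1 = t → k < x.2.1)
  have hsub : (P'.map Prod.snd).Subperm (T.filter q) := by
    have h1 : (P'.map Prod.snd).Subperm T :=
      (List.Sublist.subperm (List.Sublist.map _ List.filter_sublist)).trans hP₂
    have h2 := h1.filter q
    rwa [List.filter_eq_self.2] at h2
    intro t ht
    obtain ⟨p, hp, rfl⟩ := List.mem_map.1 ht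
    simp only [hP', List.mem_filter, decide_eq_true_eq] at hp
    simp only [q, decide_eq_true_eq]
    intro x hx hxp
    exact hDadj p.1 hp.2 x hx (by rw [hxp]; exact hP₃ p hp.1)
  have hle : (T.filter q).length ≤ S.length := by
    rw [← (h.tuples.filter q).length_eq, List.filter_map, List.length_map, hS,
      ← List.countP_eq_length_filter, ← List.countP_eq_length_filter]
    refine List.countP_mono_left fun x hx hq => ?_
    simp only [q, Function.comp_apply, decide_eq_true_eq] at hq ⊢
    exact hq x hx rfl
  have h1 := hsub.length_le
  rw [List.length_map] at h1
  omega

/-- The auction decides whether there is a matching. -/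
theorem iterate_step_eq_nil_iff (adj : C → τ → Bool) {cells : List C} (hcells : cells.Nodup)
    (T : List τ) {k : ℕ} (hk : T.length * (T.length + 1) < k) :
    ((step adj (T.length + 1))^[k] (init cells T)).2 = [] ↔ Matchable adj cells T := by
  have hinv := (inv_init adj (T.length + 1) cells T).iterate k
  refine ⟨hinv.matchable, fun hm => ?_⟩
  -- The number of rounds exceeds the largest possible sum of prices, so the state is stationary.
  have hfix := (le_total_iterate adj (T.length + 1) (init cells T) k).resolve_left
    (by have := hinv.total_le; omega)
  rcases step_cases adj (T.length + 1) ((step adj (T.length + 1))^[k] (init cells T)) with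
    ⟨-, hq | ⟨c, hc, hst⟩⟩ | ⟨c, Q, b, seen, -, hp, -, -, -, hs⟩
  · exact hq
  · exact absurd hm (hinv.not_matchable hcells (Nat.lt_succ_self _) hc hst)
  · rw [hfix] at hs
    have h1 := (hp.map fun x => x.2.1).sum_eq
    rw [hs] at h1
    simp only [List.map_cons, List.sum_cons] at h1
    omega

end Auction

/-! ### The auction runs in polynomial time. -/

namespace TreeMachine

variable {α β τ C : Type} [Code α] [Code β] [Code τ] [Code C]

theorem PT.pickStep {adj : α → τ → Bool} (hadj : PT fun p : α × τ => adj p.1 p.2)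
    {s : β → List (τ × ℕ × Option C) × Option (τ × ℕ × Option C)} {x : β → τ × ℕ × Option C}
    {a : β → α} (ha : PT a) (hs : PT s) (hx : PT x) :
    PT fun p => Auction.pickStep (adj (a p)) (s p) (x p) := by
  have hax : PT fun p => adj (a p) (x p).1 := hadj.comp₂ ha hx.fst
  refine option_cases (o := fun p => (s p).2)
    (f := fun p => bif adj (a p) (x p).1 then ((s p).1, some (x p)) else (x p :: (s p).1, none))
    (g := fun b p => bif adj (a p) (x p).1 && decide ((x p).2.1 < b.2.1) then
      (b :: (s p).1, some (x p)) else (x p :: (s p).1, some b)) hs.snd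
    (.cond hax (.pair hs.fst hx.optionSome) (.pair (.cons hx hs.fst) (.const none)))
    (.cond (.and (hax.comp (.snd .id)) (.lt (.fst (.snd (hx.comp (.snd .id))))
      (.fst (.snd (.fst .id)))))
      (.pair (.cons (.fst .id) (hs.fst.comp (.snd .id))) (hx.comp (.snd .id)).optionSome)
      (.pair (.cons (hx.comp (.snd .id)) (hs.fst.comp (.snd .id))) (PT.fst .id).optionSome))
    (fun p h => ?_) (fun p b h => ?_)
  · rw [← Prod.eta (s p), h]
    rfl
  · rw [← Prod.eta (s p), h]
    rfl

/-- By `pick_spec` the state of the scan is a rearrangement of the slots read so far, which bounds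
its size. -/
theorem PT.pick {adj : α → τ → Bool} (hadj : PT fun p : α × τ => adj p.1 p.2)
    {l : α → List (τ × ℕ × Option C)} (hl : PT l) : PT fun x => Auction.pick (adj x) (l x) := by
  refine foldl (step := fun x s a => Auction.pickStep (adj x) s a) hl (.const ([], none))
    (.pickStep hadj (.fst .id) (.fst (.snd .id)) (.snd (.snd .id)))
    (B := fun x => sz (l x) * (sz (l x) + 1) + sz (l x) + 4)
    (((hl.size.mul (hl.size.add (.const 1))).add hl.size).add (.const 4)) fun x l₁ h => ?_
  obtain ⟨h₁, -, -⟩ := Auction.pick_spec (adj x) l₁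
  change sz (Auction.pick (adj x) l₁) ≤ _
  generalize Auction.pick (adj x) l₁ = r at *
  obtain ⟨seen, b⟩ := r
  have hmem : ∀ y ∈ b.toList ++ seen, sz y ≤ sz (l x) := fun y hy =>
    sz_le_of_mem (h.subset (h₁.subset hy))
  have hlen : seen.length ≤ sz (l x) := by
    have h2 := h₁.length_eq
    have h3 := h.length_le
    have h4 := length_le_sz (l x)
    simp only [List.length_append] at h2
    omega
  have h5 := sz_list_le (l := seen) fun y hy => hmem y (List.mem_append_right _ hy)
  have h6 := Nat.mul_le_mul_right (sz (l x) + 1) hlen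
  have h7 : sz b ≤ sz (l x) + 2 := by
    rcases b with _ | b
    · simp
    · simpa using hmem b (by simp)
  rw [sz_pair]
  omega

theorem PT.bid {N : α → ℕ} {c : α → C} {Q : α → List C}
    {st : α → List (τ × ℕ × Option C) × List C}
    {r : α → List (τ × ℕ × Option C) × Option (τ × ℕ × Option C)} (hN : PT N) (hc : PT c)
    (hQ : PT Q) (hst : PT st) (hr : PT r) :
    PT fun x => Auction.bid (N x) (c x) (Q x) (st x) (r x) := by
  have ho : PT fun p : (τ × ℕ × Option C) × α => p.1.2.2.toList ++ Q p.2 :=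
    .append (option_cases (o := fun p : (τ × ℕ × Option C) × α => p.1.2.2) (f := fun _ => [])
      (g := fun d _ => [d]) (.snd (.snd (.fst .id))) (.const []) (.cons (.fst .id) (.const []))
      (fun p h => by simp [h]) fun p d h => by simp [h]) (hQ.comp (.snd .id))
  refine option_cases (o := fun x => (r x).2) (f := st)
    (g := fun b x => bif decide (b.2.1 < N x) then
      ((b.1, b.2.1 + 1, some (c x)) :: (r x).1, b.2.2.toList ++ Q x) else st x) hr.snd hst
    (.cond (.lt (.fst (.snd (.fst .id))) (hN.comp (.snd .id)))
      (.pair (.cons (.pair (.fst (.fst .id)) (.pair (.succ (.fst (.snd (.fst .id))))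
        (hc.comp (.snd .id)).optionSome)) (hr.fst.comp (.snd .id))) ho) (hst.comp (.snd .id)))
    (fun x h => ?_) (fun x b h => ?_)
  · simp [Auction.bid, h]
  · simp [Auction.bid, h]

theorem PT.auctionStep {adj : α → C → τ → Bool} (hadj : PT fun p : (α × C) × τ => adj p.1.1 p.1.2 p.2)
    {a : β → α} {N : β → ℕ} {st : β → List (τ × ℕ × Option C) × List C} (ha : PT a) (hN : PT N)
    (hst : PT st) : PT fun x => Auction.step (adj (a x)) (N x) (st x) := by
  have hp : PT fun p : (α × C) × List (τ × ℕ × Option C) => Auction.pick (adj p.1.1 p.1.2) p.2 :=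
    .pick (adj := fun (p : (α × C) × List (τ × ℕ × Option C)) t => adj p.1.1 p.1.2 t)
      (hadj.comp (f := fun q : ((α × C) × List (τ × ℕ × Option C)) × τ => (q.1.1, q.2))
        (.pair (.fst (.fst .id)) (.snd .id))) (.snd .id)
  refine list_cases (l := fun x => (st x).2) (f := st)
    (g := fun c Q x => Auction.bid (N x) c Q (st x) (Auction.pick (adj (a x) c) (st x).1)) hst.snd
    hst (.bid (hN.comp (.snd .id)) (.fst (.fst .id)) (.snd (.fst .id)) (hst.comp (.snd .id))
      (hp.comp (.pair (.pair (ha.comp (.snd .id)) (.fst (.fst .id)))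
        (hst.fst.comp (.snd .id))))) (fun x h => ?_) (fun x c Q h => ?_)
  · simp [Auction.step, h]
  · simp [Auction.step, h]

/-- The result of the auction is empty if and only if there is a matching. -/
def runAuction {τ C : Type*} (adj : C → τ → Bool) (cells : List C) (T : List τ) : Bool :=
  (((() :: T.map fun _ => ()).flatMap fun _ => (() :: T.map fun _ => ())).foldl
    (fun s _ => Auction.step adj (T.length + 1) s) (Auction.init cells T)).2.isEmpty

theorem foldl_const {α β : Type*} (f : β → β) (l : List α) (b : β) :
    l.foldl (fun s _ => f s) b = f^[l.length] b := by
  induction l generalizing b with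
  | nil => rfl
  | cons a l ih => exact ih (f b)

theorem runAuction_iff {τ C : Type*} (adj : C → τ → Bool) {cells : List C} (hcells : cells.Nodup) (T : List τ) :
    runAuction adj cells T = true ↔ Auction.Matchable adj cells T := by
  rw [runAuction, foldl_const, List.isEmpty_iff]
  refine Auction.iterate_step_eq_nil_iff adj hcells T ?_
  -- The list of units has `(|T| + 1)²` elements, more than the required `|T| (|T| + 1)`.
  simp only [List.length_flatMap, List.length_cons, List.map_const', List.length_replicate,
    List.sum_replicate, smul_eq_mul]
  exact Nat.mul_lt_mul_of_pos_right (Nat.lt_succ_self _) (Nat.succ_pos _)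

/-- The invariants bound the state independently of the number of rounds: the slots are the tuples
of `T` with prices at most `|T| + 1`, and owners and queue together are a rearrangement of the
cells. -/
theorem PT.runAuction {adj : α → C → τ → Bool}
    (hadj : PT fun p : (α × C) × τ => adj p.1.1 p.1.2 p.2) {cells : α → List C} {T : α → List τ}
    (hc : PT cells) (hT : PT T) : PT fun x => runAuction (adj x) (cells x) (T x) := by
  have hu : PT fun x => () :: (T x).map fun _ => () := .cons (.const ()) (.map hT (.const ()))
  have hi : PT fun x => Auction.init (cells x) (T x) :=
    .pair (.map (g := fun _ t => (t, 0, none)) hT (.pair (.snd .id) (.const _))) hc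
  have hs : PT fun p : α × (List (τ × ℕ × Option C) × List C) × Unit =>
      Auction.step (adj p.1) ((T p.1).length + 1) p.2.1 :=
    .auctionStep hadj (.fst .id) (.succ (.length (hT.comp (.fst .id)))) (.fst (.snd .id))
  refine (PT.snd (foldl (step := fun x s _ => Auction.step (adj x) ((T x).length + 1) s)
    (hu.flatMap (g := fun x _ => () :: (T x).map fun _ => ()) (hu.comp (.fst .id))) hi hs
    (B := fun x => (sz (T x) * (sz (T x) + (2 * (sz (T x) + 1) + 1 + (sz (cells x) + 2) + 1) + 2)
      + 1) + (sz (cells x) * (sz (cells x) + 1) + 1) + 1) ?_ fun x l₁ _ => ?_)).isEmpty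
  · have h1 := hT.size
    have h2 := hc.size
    exact (((h1.mul ((h1.add (((((PB.const 2).mul (h1.add (.const 1))).add (.const 1)).add
      (h2.add (.const 2))).add (.const 1))).add (.const 2))).add (.const 1)).add
      ((h2.mul (h2.add (.const 1))).add (.const 1))).add (.const 1)
  · rw [foldl_const]
    have h := (Auction.inv_init (adj x) ((T x).length + 1) (cells x) (T x)).iterate l₁.length
    generalize (Auction.step (adj x) ((T x).length + 1))^[l₁.length]
      (Auction.init (cells x) (T x)) = st at *
    have hT' := length_le_sz (T x)
    have hc' := length_le_sz (cells x)
    have hq : ∀ c ∈ st.2, sz c ≤ sz (cells x) := fun c hc =>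
      sz_le_of_mem (h.owners.subset (List.mem_append_right _ hc))
    have hql : st.2.length ≤ sz (cells x) := by
      have := h.owners.length_eq
      rw [List.length_append] at this
      omega
    have hsl : ∀ y ∈ st.1, sz y ≤
        sz (T x) + (2 * (sz (T x) + 1) + 1 + (sz (cells x) + 2) + 1) + 1 := by
      intro y hy
      have h1 : sz y.1 ≤ sz (T x) :=
        sz_le_of_mem (h.tuples.subset (List.mem_map_of_mem hy))
      have h2 := h.price_le y hy
      have h3 : sz y.2.2 ≤ sz (cells x) + 2 := by
        rcases ho : y.2.2 with _ | c
        · simp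
        · simpa using sz_le_of_mem (h.owners.subset (List.mem_append_left _
            (List.mem_filterMap.2 ⟨y, hy, ho⟩)))
      have h4 : sz y = sz y.1 + (sz y.2.1 + sz y.2.2 + 1) + 1 := by
        rw [← sz_pair, ← sz_pair]
      rw [sz_nat] at h4
      omega
    have h1 := sz_list_le hsl
    have h2 := sz_list_le hq
    have h3 := Nat.mul_le_mul_right (sz (T x) + (2 * (sz (T x) + 1) + 1 + (sz (cells x) + 2) + 1)
      + 1 + 1) (h.length_eq.trans_le hT')
    have h4 := Nat.mul_le_mul_right (sz (cells x) + 1) hql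
    have h5 : sz st = sz st.1 + sz st.2 + 1 := sz_pair _ _
    rw [h5]
    refine Nat.add_le_add_right (Nat.add_le_add (h1.trans (Nat.add_le_add_right h3 1))
      (h2.trans (Nat.add_le_add_right h4 1))) 1

end TreeMachine

namespace TreeMachine

/-! ### Reading the input -/

/-- Case distinction on the last symbol. -/
def caseSymbol (f : Γ' → Cmd) : Cmd :=
  .ite (fun v => decide (v = some .blank)) (f .blank)
    (.ite (fun v => decide (v = some (.bit false))) (f (.bit false))
      (.ite (fun v => decide (v = some (.bit true))) (f (.bit true))
        (.ite (fun v => decide (v = some .bra)) (f .bra)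
          (.ite (fun v => decide (v = some .ket)) (f .ket) (f .comma)))))

theorem Runs.caseSymbol {f : Γ' → Cmd} {s s' : State} {a : Γ'} {n : ℕ} (hs : s.v = some a)
    (h : Runs (f a) s s' n) : Runs (caseSymbol f) s s' (n + 5) := by
  unfold TreeMachine.caseSymbol
  rcases a with _ | (_ | _) | _ | _ | _
  · exact Runs.mono (.ite_true (by simp [hs]) h) (by omega)
  · exact Runs.mono (.ite_false (by simp [hs]) (.ite_true (by simp [hs]) h)) (by omega)
  · exact Runs.mono (.ite_false (by simp [hs]) (.ite_false (by simp [hs])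
      (.ite_true (by simp [hs]) h))) (by omega)
  · exact Runs.mono (.ite_false (by simp [hs]) (.ite_false (by simp [hs])
      (.ite_false (by simp [hs]) (.ite_true (by simp [hs]) h)))) (by omega)
  · exact Runs.mono (.ite_false (by simp [hs]) (.ite_false (by simp [hs])
      (.ite_false (by simp [hs]) (.ite_false (by simp [hs]) (.ite_true (by simp [hs]) h)))))
      (by omega)
  · exact Runs.mono (.ite_false (by simp [hs]) (.ite_false (by simp [hs])
      (.ite_false (by simp [hs]) (.ite_false (by simp [hs]) (.ite_false (by simp [hs]) h)))))
      (by omega)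

/-- Move the input to the stack `W`. -/
def moveInput : Cmd :=
  .pop .I ;; .loop Option.isSome (caseSymbol (.push .W) ;; .pop .I)

/-- Write the word on the stack `W` as a tree. -/
def codeInput : Cmd :=
  .push .V (.bit false) ;; .pop .W ;; .loop Option.isSome
    (caseSymbol (fun a => pushTree (Code.tree a) ;; .push .V (.bit true)) ;; .pop .W)

theorem Runs.moveInput (w : List Γ') : ∀ (v : Option Γ') (V W Z C : List Γ'),
    Runs moveInput ⟨v, w, V, W, Z, C⟩ ⟨none, [], V, w.reverse ++ W, Z, C⟩ (8 * w.length + 2) := by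
  induction w with
  | nil => exact fun v V W Z C => (Runs.pop _ _).seq (Runs.loop_false rfl)
  | cons a w ih =>
    intro v V W Z C
    obtain ⟨m, hm, h⟩ := ih v V (a :: W) Z C
    -- The run for the shorter word starts with the same pop; inversion exposes the loop after it,
    -- which continues the present one.
    cases h with
    | seq h₁ h₂ =>
      cases h₁
      rw [List.reverse_cons, List.append_assoc]
      refine Runs.mono ((Runs.pop _ _).seq (Runs.loop_true rfl ((Runs.caseSymbol rfl
        (Runs.push _ _ _)).seq (Runs.pop _ _)) ⟨_, le_rfl, h₂⟩)) ?_
      rw [List.length_cons]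
      omega

theorem sz_symbol_le (a : Γ') : sz a ≤ 11 := by
  rcases a with _ | (_ | _) | _ | _ | _ <;> simp [sz, Code.tree, symbolIndex, natTree]

/-- The stack `W` holds the input reversed, so the last symbol comes first and each symbol is put in
front of the list built so far. A symbol costs 19 steps: five for the case distinction, at most
eleven for its tree, and one each for the list node, the pop and the test. -/
theorem Runs.codeLoop (w : List Γ') : ∀ (I Z C u : List Γ'),
    Runs (.pop .W ;; .loop Option.isSome
      (TreeMachine.caseSymbol (fun a => TreeMachine.pushTree (Code.tree a) ;; .push .V (.bit true)) ;;
        .pop .W))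
      ⟨none, I, word u, w, Z, C⟩ ⟨none, I, word (w.reverse ++ u), [], Z, C⟩
      (19 * w.length + 2) := by
  induction w with
  | nil => exact fun I Z C u => (Runs.pop _ _).seq (Runs.loop_false rfl)
  | cons a w ih =>
    intro I Z C u
    obtain ⟨m, hm, h⟩ := ih I Z C (a :: u)
    cases h with
    | seq h₁ h₂ =>
      cases h₁
      rw [List.reverse_cons, List.append_assoc]
      refine Runs.mono ((Runs.pop _ _).seq (Runs.loop_true rfl ((Runs.caseSymbol (a := a) rfl
        ((Runs.pushTree (Code.tree a) _ _ _ _ _ _).seq (Runs.push _ _ _))).seq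
        (Runs.pop .W ⟨some a, I, word (a :: u), w, Z, C⟩)) ⟨_, le_rfl, h₂⟩)) ?_
      have := sz_symbol_le a
      unfold sz at this
      rw [List.length_cons]
      omega

/-- Replace the tree of a truth value by a single bit. -/
def finish : Cmd :=
  .pop .V ;; .ite isOne (.pop .V ;; .pop .V ;; .push .V (.bit true)) (.push .V (.bit false))

theorem Runs.finish (b : Bool) (v : Option Γ') :
    ∃ v', Runs finish ⟨v, [], word b, [], [], []⟩ ⟨v', [], [.bit b], [], [], []⟩ 5 := by
  cases b
  · exact ⟨some (.bit false), Runs.mono ((Runs.pop _ _).seq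
      (Runs.ite_false rfl (Runs.push _ _ _))) (by omega)⟩
  · exact ⟨some (.bit false), Runs.mono ((Runs.pop _ _).seq
      (Runs.ite_true rfl ((Runs.pop _ _).seq ((Runs.pop _ _).seq (Runs.push _ _ _)))))
      (by omega)⟩

/-- A problem is in `P` if it is decided by a polynomial time function of the input word. -/
theorem inP_of_pt {α : Type} {enc : α → List Γ'} {p : α → Prop} {f : List Γ' → Bool} (hf : PT f)
    (h : ∀ a, f (enc a) = true ↔ p a) : SpCJ.InP enc p := by
  classical
  obtain ⟨c, T, ⟨P, hP⟩, -, hc⟩ := hf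
  -- `27 n + 10` collects moving, coding and finishing; `12 n + 1` bounds the size of the coded
  -- word, since a symbol has size at most 11 and its list node adds 1.
  refine inP_of_runs enc p (moveInput ;; codeInput ;; c ;; finish)
    (27 * .X + P.comp (12 * .X + 1) + 10) fun a => ?_
  have hb : decide (p a) = f (enc a) := by
    rw [← Bool.coe_iff_coe, decide_eq_true_iff, h]
  obtain ⟨v₁, h₁⟩ := hc (enc a) none [] [] [] [] []
  obtain ⟨v₂, h₂⟩ := Runs.finish (f (enc a)) v₁
  have h₃ := Runs.codeLoop (enc a).reverse [] [] [] []
  rw [List.reverse_reverse, List.append_nil, List.length_reverse] at h₃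
  rw [List.append_nil, List.append_nil] at h₁
  have h₄ := Runs.moveInput (enc a) none [] [] [] []
  rw [List.append_nil] at h₄
  refine ⟨v₂, ?_⟩
  rw [hb]
  refine Runs.mono (h₄.seq (((Runs.push _ _ _).seq h₃).seq (h₁.seq h₂))) ?_
  have h₅ := sz_list_le (l := enc a) fun b _ => sz_symbol_le b
  have h₆ := (hP (enc a)).trans (eval_mono P (m := 12 * (enc a).length + 1) (by omega))
  simp only [Polynomial.eval_add, Polynomial.eval_mul, Polynomial.eval_X, Polynomial.eval_ofNat,
    Polynomial.eval_one, Polynomial.eval_comp]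
  omega

/-! ### The decision procedure -/

/-- The words for entries of the table. -/
abbrev Wd : Type :=
  List Γ'

/-- The test whether a symbol is a bit. -/
def isBit (a : Γ') : Bool :=
  decide (a = .bit true) || decide (a = .bit false)

/-- One step of reading the schema, where the flag tells that the schema is complete. -/
def schemaStep (s : Wd × Bool) (a : Γ') : Wd × Bool :=
  bif s.2 then s else bif isBit a then (a :: s.1, false) else (s.1, true)

/-- The leading bits of a word. -/
def schemaBits (w : Wd) : Wd :=
  (w.foldl schemaStep ([], false)).1.reverse

/-- The test whether the first symbol is `1`. -/
def headTrue : Wd → Bool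
  | [] => false
  | b :: _ => decide (b = .bit true)

/-- The state of the parser: the current entry, the remaining schema, the last entries at the two
marked attributes, a flag that tells whether these are equal, and the list of the pairs read. -/
abbrev ParseState : Type :=
  Wd × Wd × (Wd × Wd) × Bool × List (Wd × Wd)

/-- The state of the parser at the end of an entry. -/
def endEntry (s : ParseState) : ParseState :=
  ([], s.2.1.tail.tail, (bif headTrue s.2.1 then s.1 else s.2.2.1.1,
    bif headTrue s.2.1.tail then s.1 else s.2.2.1.2),
    s.2.2.2.1 || (headTrue s.2.1 && headTrue s.2.1.tail), s.2.2.2.2)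

/-- One step of the parser. -/
def parseStep (sch : Wd) (s : ParseState) (a : Γ') : ParseState :=
  bif decide (a = .bra) then ([], sch, ([], []), s.2.2.2)
  else bif decide (a = .ket) then (s.1, s.2.1, s.2.2.1, s.2.2.2.1, s.2.2.1 :: s.2.2.2.2)
  else bif decide (a = .comma) then endEntry s
  else (a :: s.1, s.2)

/-- The pairs of entries at the marked attributes, and the flag whether these are equal. -/
def parse (w : Wd) : Bool × List (Wd × Wd) :=
  (w.foldl (parseStep (schemaBits w)) ([], [], ([], []), false, [])).2.2.2

/-- The word of the null marker. -/
def nullWord : Wd :=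
  [.blank]

/-- The values in a list of entries. -/
def values (l : List Wd) : List Wd :=
  l.foldr (fun w acc => bif decide (w = nullWord) || acc.any (fun u => decide (u = w)) then acc
    else w :: acc) []

/-- The active domain, where the word of the null marker stands for the special symbol. -/
def domainWords (l : List Wd) : List Wd :=
  bif (values l).isEmpty then [nullWord] else values l

/-- The pairs to be matched. -/
def cells (l : List (Wd × Wd)) : List (Wd × Wd) :=
  (domainWords (l.map Prod.fst)).flatMap fun a => (domainWords (l.map Prod.snd)).map fun b => (a, b)

/-- The test whether a pair of entries is similar to a pair of values. -/
def similar (e : Bool) (c t : Wd × Wd) : Bool :=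
  ((decide (t.1 = nullWord) || decide (t.1 = c.1)) &&
    (decide (t.2 = nullWord) || decide (t.2 = c.2))) && (!e || decide (c.1 = c.2))

/-- The decision procedure for the problem. -/
def decideWord (w : Wd) : Bool :=
  (parse w).2.isEmpty || runAuction (similar (parse w).1) (cells (parse w).2) (parse w).2

theorem sz_word_le (w : Wd) : sz w ≤ 12 * w.length + 1 := by
  have := sz_list_le (l := w) fun b _ => sz_symbol_le b
  omega

variable {α : Type} [Code α]

theorem PT.isBit {f : α → Γ'} (hf : PT f) : PT fun x => isBit (f x) :=
  .or (.symbol_eq hf (.const _)) (.symbol_eq hf (.const _))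

theorem PT.headTrue {f : α → Wd} (hf : PT f) : PT fun x => headTrue (f x) :=
  list_cases (f := fun _ => false) (g := fun b _ _ => decide (b = .bit true)) hf (.const _)
    (.symbol_eq (.fst (.fst .id)) (.const _)) (fun x h => by rw [h]; rfl)
    fun x b r h => by rw [h]; rfl

theorem PT.schemaBits {f : α → Wd} (hf : PT f) : PT fun x => schemaBits (f x) := by
  refine (PT.fst (foldl (step := fun _ s a => schemaStep s a) hf (.const ([], false))
    (.cond (.snd (.fst (.snd .id))) (.fst (.snd .id)) (.cond (.isBit (.snd (.snd .id)))
      (.pair (.cons (.snd (.snd .id)) (.fst (.fst (.snd .id)))) (.const _))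
      (.pair (.fst (.fst (.snd .id))) (.const _))))
    (B := fun x => 12 * sz (f x) + 5) (((PB.const 12).mul hf.size).add (.const 5))
    fun x l₁ h => ?_)).reverse
  have key : ∀ (l : List Γ') (s : Wd × Bool),
      (l.foldl schemaStep s).1.length ≤ l.length + s.1.length := by
    intro l
    induction l with
    | nil => simp
    | cons a l ih =>
      intro s
      refine (ih (schemaStep s a)).trans ?_
      unfold schemaStep
      cases s.2 <;> cases TreeMachine.isBit a <;>
        simp only [cond_true, cond_false, List.length_cons] <;> omega
  have h1 := key l₁ ([], false)
  have h2 := h.length_le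
  have h3 := length_le_sz (f x)
  generalize l₁.foldl schemaStep ([], false) = s at *
  have h4 := sz_word_le s.1
  have h5 := sz_bool s.2
  have h6 : sz s = sz s.1 + sz s.2 + 1 := sz_pair _ _
  rw [List.length_nil] at h1
  omega

/-- A bound for the components of the state of the parser. -/
structure ParseState.Bounded (n k : ℕ) (s : ParseState) : Prop where
  cur : s.1.length ≤ k
  rem : s.2.1.length ≤ n
  fst : s.2.2.1.1.length ≤ k
  snd : s.2.2.1.2.length ≤ k
  out : s.2.2.2.2.length ≤ k
  mem : ∀ p ∈ s.2.2.2.2, p.1.length ≤ k ∧ p.2.length ≤ k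

/-- One symbol lengthens the current entry or the output by at most one, and recorded entries are
copies of the current one. The remaining schema is only reset or shortened, which is why its bound
`n` stays fixed. -/
theorem ParseState.Bounded.step {n k : ℕ} {s : ParseState} (h : s.Bounded n k) {sch : Wd}
    (hs : sch.length ≤ n) (a : Γ') : (parseStep sch s a).Bounded n (k + 1) := by
  obtain ⟨cur, rem, ⟨x, y⟩, e, out⟩ := s
  obtain ⟨h₁, h₂, h₃, h₄, h₅, h₆⟩ := h
  dsimp only at *
  have h₇ : ∀ p ∈ out, p.1.length ≤ k + 1 ∧ p.2.length ≤ k + 1 := fun p hp =>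
    ⟨(h₆ p hp).1.trans (Nat.le_succ k), (h₆ p hp).2.trans (Nat.le_succ k)⟩
  unfold parseStep
  by_cases ha : a = .bra
  · simp only [ha, decide_true, cond_true]
    constructor <;> simp <;> first | omega | exact fun u v h => h₇ _ h
  by_cases ha' : a = .ket
  · simp only [ha', decide_true, cond_true]
    constructor <;> simp <;> first | omega | skip
    exact ⟨⟨by omega, by omega⟩, fun u v h => h₇ _ h⟩
  by_cases ha'' : a = .comma
  · simp only [ha'', decide_true, cond_true]
    have h₈ : rem.tail.tail.length ≤ n := by
      simp only [List.length_tail]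
      omega
    constructor
    · exact Nat.zero_le _
    · exact h₈
    · change (bif TreeMachine.headTrue rem then cur else x).length ≤ _
      cases TreeMachine.headTrue rem <;> simp only [cond_true, cond_false] <;> omega
    · change (bif TreeMachine.headTrue rem.tail then cur else y).length ≤ _
      cases TreeMachine.headTrue rem.tail <;> simp only [cond_true, cond_false] <;> omega
    · exact h₅.trans (Nat.le_succ k)
    · exact h₇
  · simp only [ha, ha', ha'', decide_false, cond_false]
    constructor <;> simp <;> first | omega | exact fun u v h => h₇ _ h

theorem ParseState.Bounded.foldl {n : ℕ} {sch : Wd} (hs : sch.length ≤ n) (l : List Γ') :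
    ∀ {k : ℕ} {s : ParseState}, s.Bounded n k →
      (l.foldl (parseStep sch) s).Bounded n (k + l.length) := by
  induction l with
  | nil => exact fun h => h
  | cons a l ih =>
    intro k s h
    rw [List.length_cons, Nat.add_comm l.length 1, ← Nat.add_assoc]
    exact ih (h.step hs a)

theorem ParseState.Bounded.sz_le {n k : ℕ} {s : ParseState} (h : s.Bounded n k) :
    sz s ≤ (12 * k + 1) + ((12 * n + 1) + ((12 * k + 1) + (12 * k + 1) + 1 +
      (3 + (k * (24 * k + 4) + 1) + 1) + 1) + 1) + 1 := by
  obtain ⟨cur, rem, ⟨x, y⟩, e, out⟩ := s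
  obtain ⟨h₁, h₂, h₃, h₄, h₅, h₆⟩ := h
  dsimp only at *
  have h1 := sz_word_le cur
  have h2 := sz_word_le rem
  have h3 := sz_word_le x
  have h4 := sz_word_le y
  have h5 := sz_bool e
  have h6 : sz out ≤ out.length * (24 * k + 4) + 1 := sz_list_le fun p hp => by
    have := sz_word_le p.1
    have := sz_word_le p.2
    have := h₆ p hp
    have : sz p = sz p.1 + sz p.2 + 1 := sz_pair _ _
    omega
  have h7 := Nat.mul_le_mul_right (24 * k + 4) h₅
  simp only [sz_pair]
  omega

theorem PT.endEntry {f : α → ParseState} (hf : PT f) : PT fun x => endEntry (f x) := by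
  have h₁ := hf.snd.fst.headTrue
  have h₂ := hf.snd.fst.tail.headTrue
  exact .pair (.const _) (.pair hf.snd.fst.tail.tail (.pair (.pair (.cond h₁ hf.fst
    hf.snd.snd.fst.fst) (.cond h₂ hf.fst hf.snd.snd.fst.snd)) (.pair
    (.or hf.snd.snd.snd.fst (.and h₁ h₂)) hf.snd.snd.snd.snd)))

theorem PT.parse {f : α → Wd} (hf : PT f) : PT fun x => parse (f x) := by
  refine .snd (.snd (.snd (foldl (i := fun _ => (([], [], ([], []), false, []) : ParseState))
    (step := fun x s a => parseStep (TreeMachine.schemaBits (f x)) s a) hf (.const _) ?_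
    (B := fun x => (12 * sz (f x) + 1) + ((12 * sz (TreeMachine.schemaBits (f x)) + 1) +
      ((12 * sz (f x) + 1) + (12 * sz (f x) + 1) + 1 +
      (3 + (sz (f x) * (24 * sz (f x) + 4) + 1) + 1) + 1) + 1) + 1) ?_ fun x l₁ h => ?_)))
  · have h₁ : PT fun p : α × ParseState × Γ' => p.2.1 := .fst (.snd .id)
    have h₂ : PT fun p : α × ParseState × Γ' => p.2.2 := .snd (.snd .id)
    exact .cond (.symbol_eq h₂ (.const _)) (.pair (.const _) (.pair (hf.schemaBits.comp (.fst .id))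
      (.pair (.const _) h₁.snd.snd.snd))) (.cond (.symbol_eq h₂ (.const _))
      (.pair h₁.fst (.pair h₁.snd.fst (.pair h₁.snd.snd.fst (.pair h₁.snd.snd.snd.fst
        (.cons h₁.snd.snd.fst h₁.snd.snd.snd.snd))))) (.cond (.symbol_eq h₂ (.const _))
        (.endEntry h₁) (.pair (.cons h₂ h₁.fst) h₁.snd)))
  · have h₁ := hf.size
    have h₂ := ((PB.const 12).mul h₁).add (.const 1)
    exact (h₂.add (((((PB.const 12).mul hf.schemaBits.size).add (.const 1)).add
      (((h₂.add h₂).add (.const 1)).add (((PB.const 3).add ((h₁.mul (((PB.const 24).mul h₁).add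
        (.const 4))).add (.const 1))).add (.const 1)) |>.add (.const 1))).add (.const 1))).add
      (.const 1)
  · have h₀ : ParseState.Bounded (TreeMachine.schemaBits (f x)).length 0
        (([], [], ([], []), false, []) : ParseState) := by
      constructor <;> simp
    have h₁ := (h₀.foldl le_rfl l₁).sz_le
    have h₂ : 0 + l₁.length ≤ sz (f x) := by
      have := h.length_le
      have := length_le_sz (f x)
      omega
    have h₃ := length_le_sz (TreeMachine.schemaBits (f x))
    refine h₁.trans ?_
    gcongr

theorem sz_le_of_sublist {β : Type} [Code β] {l₁ l₂ : List β} (h : l₁.Sublist l₂) :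
    sz l₁ ≤ sz l₂ := by
  induction h with
  | slnil => exact le_rfl
  | cons a _ ih =>
    rw [sz_cons]
    omega
  | cons_cons a _ ih =>
    rw [sz_cons, sz_cons]
    omega

/-- This bounds the intermediate results of the fold that computes `values`. -/
theorem values_sublist (l : List Wd) : (values l).Sublist l := by
  induction l with
  | nil => exact .slnil
  | cons a l ih =>
    change (bif decide (a = nullWord) || (values l).any (fun u => decide (u = a)) then values l
      else a :: values l).Sublist _
    cases decide (a = nullWord) || (values l).any (fun u => decide (u = a))
    · exact ih.cons_cons a
    · exact ih.cons a

theorem PT.domainWords {f : α → List Wd} (hf : PT f) : PT fun x => domainWords (f x) := by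
  have h : PT fun x => values (f x) := by
    refine foldr (step := fun _ w acc => bif decide (w = nullWord) ||
        acc.any (fun u => decide (u = w)) then acc else w :: acc) hf (.const [])
      (.cond (.or (.word_eq (.fst (.snd .id)) (.const _)) (.any (.snd (.snd .id))
        (.word_eq (.snd .id) (.fst (.snd (.fst .id)))))) (.snd (.snd .id))
        (.cons (.fst (.snd .id)) (.snd (.snd .id)))) hf.size fun x l₁ hl => ?_
    exact (sz_le_of_sublist (values_sublist l₁)).trans (sz_le_of_sublist hl.sublist)
  exact .cond h.isEmpty (.const _) h

theorem PT.cells {f : α → List (Wd × Wd)} (hf : PT f) : PT fun x => cells (f x) := by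
  have h₁ : PT fun x => TreeMachine.domainWords ((f x).map Prod.fst) :=
    .domainWords (.map (g := fun _ p => p.1) hf (.fst (.snd .id)))
  have h₂ : PT fun x => TreeMachine.domainWords ((f x).map Prod.snd) :=
    .domainWords (.map (g := fun _ p => p.2) hf (.snd (.snd .id)))
  exact .flatMap (g := fun x a => (TreeMachine.domainWords ((f x).map Prod.snd)).map
    fun b => (a, b)) h₁ (.map (g := fun p b => (p.2, b)) (h₂.comp (.fst .id))
      (.pair (.snd (.fst .id)) (.snd .id)))

theorem PT.decideWord : PT decideWord := by
  have h : PT fun w : Wd => TreeMachine.parse w := .parse .id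
  refine .or h.snd.isEmpty (.runAuction (adj := fun w c t => similar (TreeMachine.parse w).1 c t)
    ?_ h.snd.cells h.snd)
  have h₁ : PT fun p : (Wd × (Wd × Wd)) × (Wd × Wd) => p.1.2 := .snd (.fst .id)
  have h₂ : PT fun p : (Wd × (Wd × Wd)) × (Wd × Wd) => p.2 := .snd .id
  exact .and (.and (.or (.word_eq h₂.fst (.const _)) (.word_eq h₂.fst h₁.fst))
    (.or (.word_eq h₂.snd (.const _)) (.word_eq h₂.snd h₁.snd)))
    (.or (.not (h.fst.comp (.fst (.fst .id)))) (.word_eq h₁.fst h₁.snd))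

end TreeMachine

/-! ### Strongly possible cross joins and matchings. -/

namespace SpCJ

variable {R : Type u} {dom : R → Type v}

theorem exists_mem_activeDomain (T : Table R dom) (A : R) : ∃ a, a ∈ activeDomain T A := by
  rcases (occurringValues T A).eq_empty_or_nonempty with h | ⟨d, hd⟩
  · exact ⟨.ssymb, .inr ⟨rfl, h⟩⟩
  · exact ⟨.val d, .inl ⟨d, hd, rfl⟩⟩

/-- In a strongly possible world, all values of the active domain occur. -/
theorem IsSpWorld.exists_eq {T : Table R dom} {T' : Table R fun A => Ext (dom A)}
    (h : IsSpWorld T T') (hT : T ≠ []) {A : R} {a : Ext (dom A)} (ha : a ∈ activeDomain T A) :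
    ∃ t ∈ T', t A = some a := by
  rcases ha with ⟨d, ⟨t, ht, htd⟩, rfl⟩ | ⟨rfl, he⟩
  · obtain ⟨i, hi⟩ := List.get_of_mem ht
    have hlen := h.1.1.length_eq
    have hsim := (List.forall₂_iff_get.1 h.1.1).2 i i.2 (hlen ▸ i.2)
    refine ⟨_, List.get_mem T' ⟨i, hlen ▸ i.2⟩, ?_⟩
    rcases hsim A (Set.mem_univ A) with h1 | h1 | h1
    · rw [← h1]
      simp only [Fin.eta, hi, Tuple.toExt, htd, Option.map_some]
    · simp only [Fin.eta, hi, Tuple.toExt, htd, Option.map_some, reduceCtorEq] at h1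
    · exact absurd h1 (h.1.2 _ (List.get_mem T' ⟨i, hlen ▸ i.2⟩) A)
  -- Here the active domain is `{ssymb}`, so any tuple of the world will do; one exists because the
  -- table is nonempty.
  · have hT' : T' ≠ [] := by
      rintro rfl
      exact hT (List.eq_nil_of_length_eq_zero h.1.1.length_eq)
    obtain ⟨a, ha, hta⟩ := h.2 _ (List.head_mem hT') A
    refine ⟨_, List.head_mem hT', hta.trans ?_⟩
    rcases ha with ⟨d, hd, -⟩ | ⟨rfl, -⟩
    · rw [he] at hd
      exact absurd hd (Set.notMem_empty d)
    · rfl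

/-- The table satisfies the cross join if and only if the pairs of values of the active domains can
be assigned to different similar tuples. -/
theorem satisfiesSpCJ_iff {T : Table R dom} (hT : T ≠ []) (X Y : R) :
    SatisfiesSpCJ T {X} {Y} ↔ ∃ f : activeDomain T X × activeDomain T Y → Fin T.length,
      Function.Injective f ∧ ∀ p, SimilarToPair (T.get (f p)) X Y p.1.1 p.2.1 := by
  classical
  constructor
  · rintro ⟨T', hT', hCJ⟩
    have hlen := hT'.1.1.length_eq
    have h1 : ∀ p : activeDomain T X × activeDomain T Y, ∃ i : Fin T'.length,
        T'.get i X = some p.1.1 ∧ T'.get i Y = some p.2.1 := by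
      rintro ⟨⟨a, ha⟩, ⟨b, hb⟩⟩
      obtain ⟨t₁, ht₁, h₁⟩ := hT'.exists_eq hT ha
      obtain ⟨t₂, ht₂, h₂⟩ := hT'.exists_eq hT hb
      obtain ⟨t, ht, h₃, h₄⟩ := hCJ t₁ ht₁ t₂ ht₂
      obtain ⟨i, rfl⟩ := List.get_of_mem ht
      exact ⟨i, (h₃ X rfl).trans h₁, (h₄ Y rfl).trans h₂⟩
    choose g hg using h1
    refine ⟨fun p => (g p).cast hlen.symm, fun p q hpq => ?_, fun p => ?_⟩
    -- A tuple of the world determines its values at `X` and `Y`, hence the pair.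
    · have h2 : g p = g q := by simpa using hpq
      have hX : some p.1.1 = some q.1.1 := by rw [← (hg p).1, ← (hg q).1, h2]
      have hY : some p.2.1 = some q.2.1 := by rw [← (hg p).2, ← (hg q).2, h2]
      exact Prod.ext (Subtype.ext (Option.some.inj hX)) (Subtype.ext (Option.some.inj hY))
    · refine ⟨T'.get (g p), (hg p).1, (hg p).2, fun A _ => ?_⟩
      exact (List.forall₂_iff_get.1 hT'.1.1).2 (g p) ((g p).2.trans_eq hlen.symm) (g p).2 A (Set.mem_univ A)
  · rintro ⟨f, hf, hs⟩
    choose s hsX hsY hsim using hs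
    choose dflt hdflt using exists_mem_activeDomain T
    -- The world: tuples chosen by `f` take the values of their pair at `X` and `Y`; every other
    -- entry keeps its value, or gets a default from the active domain if it is null.
    let w : Fin T.length → Tuple R (fun A => Ext (dom A)) := fun i A =>
      if h : ∃ p, f p = i ∧ (A = X ∨ A = Y) then s h.choose A
      else some ((Tuple.toExt (T.get i) A).getD (dflt A))
    have hw : ∀ p A, A = X ∨ A = Y → w (f p) A = s p A := by
      intro p A hA
      have h : ∃ q, f q = f p ∧ (A = X ∨ A = Y) := ⟨p, rfl, hA⟩
      -- By injectivity the pair selected in the definition of `w` is `p` itself.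
      have h1 := hf h.choose_spec.1
      simp only [w, dif_pos h]
      rw [h1]
    have hval : ∀ i A, ∃ a ∈ activeDomain T A, w i A = some a := by
      intro i A
      by_cases h : ∃ p, f p = i ∧ (A = X ∨ A = Y)
      · obtain ⟨p, rfl, hA⟩ := h
        rw [hw p A hA]
        rcases hA with rfl | rfl
        · exact ⟨_, p.1.2, hsX p⟩
        · exact ⟨_, p.2.2, hsY p⟩
      · simp only [w, dif_neg h]
        refine ⟨_, ?_, rfl⟩
        rcases hd : T.get i A with _ | d
        · simpa only [Tuple.toExt, hd, Option.map_none, Option.getD_none] using hdflt A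
        · simp only [Tuple.toExt, hd, Option.map_some, Option.getD_some]
          exact .inl ⟨d, ⟨_, List.get_mem T i, hd⟩, rfl⟩
    have hws : ∀ i A, Tuple.toExt (T.get i) A = w i A ∨ Tuple.toExt (T.get i) A = none ∨
        w i A = none := by
      intro i A
      by_cases h : ∃ p, f p = i ∧ (A = X ∨ A = Y)
      · obtain ⟨p, rfl, hA⟩ := h
        rw [hw p A hA]
        exact hsim p A hA
      · simp only [w, dif_neg h]
        rcases hd : T.get i A with _ | d
        · simp [Tuple.toExt, hd]
        · simp [Tuple.toExt, hd]
    have hlen : (List.ofFn w).length = T.length := List.length_ofFn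
    refine ⟨List.ofFn w, ⟨⟨List.forall₂_iff_get.2 ⟨hlen.symm, fun i hi hi' A _ => ?_⟩, ?_⟩, ?_⟩, ?_⟩
    · simp only [List.get_eq_getElem, List.getElem_ofFn]
      exact hws ⟨i, hi⟩ A
    · intro t' ht' A hA
      obtain ⟨i, rfl⟩ := (List.mem_ofFn' w t').1 ht'
      obtain ⟨a, -, ha⟩ := hval i A
      rw [ha] at hA
      exact absurd hA (by simp)
    · intro t' ht' A
      obtain ⟨i, rfl⟩ := (List.mem_ofFn' w t').1 ht'
      exact hval i A
    · intro t₁ ht₁ t₂ ht₂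
      obtain ⟨i, rfl⟩ := (List.mem_ofFn' w t₁).1 ht₁
      obtain ⟨j, rfl⟩ := (List.mem_ofFn' w t₂).1 ht₂
      -- The two values to be combined lie in the active domains, so they form a pair, and the tuple
      -- assigned to this pair is the witness.
      obtain ⟨a, ha, hia⟩ := hval i X
      obtain ⟨b, hb, hjb⟩ := hval j Y
      refine ⟨w (f (⟨a, ha⟩, ⟨b, hb⟩)), (List.mem_ofFn' w _).2 ⟨_, rfl⟩, ?_, ?_⟩
      · rintro A rfl
        rw [hw _ _ (.inl rfl), hia]
        exact hsX _
      · rintro A rfl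
        rw [hw _ _ (.inr rfl), hjb]
        exact hsY _

/-- An assignment of the pairs to different similar tuples is a matching of the graph. -/
theorem exists_injective_iff_exists_isMatching (T : Table R dom) (X Y : R) :
    (∃ f : activeDomain T X × activeDomain T Y → Fin T.length,
      Function.Injective f ∧ ∀ p, SimilarToPair (T.get (f p)) X Y p.1.1 p.2.1) ↔
    ∃ M : (pairGraph T X Y).Subgraph, M.IsMatching ∧ Set.range Sum.inr ⊆ M.verts := by
  constructor
  · rintro ⟨f, hf, hs⟩
    refine ⟨{ verts := {v | ∃ p, v = .inr p ∨ v = .inl (f p)}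
              Adj := fun v w => ∃ p, v = .inr p ∧ w = .inl (f p) ∨ v = .inl (f p) ∧ w = .inr p
              adj_sub := ?_
              edge_vert := ?_
              symm := ⟨?_⟩ }, ?_, ?_⟩
    · rintro v w ⟨p, ⟨rfl, rfl⟩ | ⟨rfl, rfl⟩⟩
      · exact ⟨by simp, .inr ⟨f p, p.1, p.2, rfl, rfl, hs p⟩⟩
      · exact ⟨by simp, .inl ⟨f p, p.1, p.2, rfl, rfl, hs p⟩⟩
    · rintro v w ⟨p, ⟨rfl, rfl⟩ | ⟨rfl, rfl⟩⟩
      exacts [⟨p, .inl rfl⟩, ⟨p, .inr rfl⟩]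
    · rintro v w ⟨p, h | h⟩
      exacts [⟨p, .inr h.symm⟩, ⟨p, .inl h.symm⟩]
    · rintro v ⟨p, rfl | rfl⟩
      · refine ⟨.inl (f p), ⟨p, .inl ⟨rfl, rfl⟩⟩, ?_⟩
        rintro w ⟨q, ⟨h, rfl⟩ | ⟨h, rfl⟩⟩
        · rw [Sum.inr.inj h]
        · exact absurd h (by simp)
      · refine ⟨.inr p, ⟨p, .inr ⟨rfl, rfl⟩⟩, ?_⟩
        rintro w ⟨q, ⟨h, rfl⟩ | ⟨h, rfl⟩⟩
        · exact absurd h (by simp)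
        · rw [hf (Sum.inl.inj h)]
    · rintro _ ⟨p, rfl⟩
      exact ⟨p, .inl rfl⟩
  · rintro ⟨M, hM, hv⟩
    have h1 : ∀ p : activeDomain T X × activeDomain T Y, ∃ i : Fin T.length,
        M.Adj (.inr p) (.inl i) ∧ SimilarToPair (T.get i) X Y p.1.1 p.2.1 := by
      intro p
      obtain ⟨w, hw, -⟩ := hM (hv ⟨p, rfl⟩)
      rcases (M.adj_sub hw).2 with ⟨i, a, b, h, -⟩ | ⟨i, a, b, h, h', hs⟩
      · exact absurd h (by simp)
      · subst h
        cases Sum.inr.inj h'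
        exact ⟨i, hw, hs⟩
    choose f hf hs using h1
    refine ⟨f, fun p q hpq => ?_, hs⟩
    -- If `f p = f q`, the same left vertex is matched with both `p` and `q`.
    have h2 := hf q
    rw [← hpq] at h2
    obtain ⟨w, -, hw⟩ := hM (M.edge_vert (hf p).symm)
    exact Sum.inr.inj ((hw _ (hf p).symm).trans (hw _ h2.symm).symm)

end SpCJ

/-! ### Correctness of the decision procedure on encoded instances. -/

namespace TreeMachine

open SpCJ

variable {D : Type} (code : D → List Bool)

/-- The word of an entry, reversed. -/
def entryWord : Option D → Wd
  | none => nullWord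
  | some d => ((code d).map Γ'.bit).reverse

/-- The word of a value of the extended domain. -/
def extWord : Ext D → Wd
  | .val d => entryWord code (some d)
  | .ssymb => nullWord

/-- The entries of a tuple at two attributes, as words. -/
def entryPair {n : ℕ} (X Y : Fin n) (t : Fin n → Option D) : Wd × Wd :=
  (entryWord code (t X), entryWord code (t Y))

/-- Words of values consist of bits and contain no blank. So the null word is free to stand for
`ssymb` among the values. -/
theorem entryWord_some_ne_nullWord (d : D) : entryWord code (some d) ≠ nullWord := by
  intro h
  have h1 : Γ'.blank ∈ entryWord code (some d) := by
    rw [h]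
    exact List.mem_singleton.2 rfl
  simp [entryWord] at h1

theorem extWord_injective {code : D → List Bool} (hcode : Function.Injective code) :
    Function.Injective (extWord code) := by
  have hb : Function.Injective Γ'.bit := fun a b h => Γ'.bit.inj h
  rintro (d | _) (d' | _) h
  · exact congrArg Ext.val (hcode (hb.list_map (List.reverse_injective h)))
  · exact absurd h (entryWord_some_ne_nullWord code d)
  · exact absurd h.symm (entryWord_some_ne_nullWord code d')
  · rfl

/-! ### The parser reads the code of an instance -/

/-- Symbols are put in front of the current entry, so it is read in reverse; this is the reason for
the reversal in `entryWord`. -/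
theorem foldl_parseStep_of_forall {sch l : Wd} (hl : ∀ a ∈ l, a ≠ .bra ∧ a ≠ .ket ∧ a ≠ .comma)
    (s : ParseState) : l.foldl (parseStep sch) s = (l.reverse ++ s.1, s.2) := by
  induction l generalizing s with
  | nil => rfl
  | cons a l ih =>
    obtain ⟨⟨h₁, h₂, h₃⟩, hl⟩ := List.forall_mem_cons.1 hl
    have h : parseStep sch s a = (a :: s.1, s.2) := by simp [parseStep, h₁, h₂, h₃]
    rw [List.foldl_cons, h, ih hl]
    simp

theorem foldl_parseStep_entry (sch : Wd) (o : Option D) (s : ParseState) :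
    (encodeEntry code o).foldl (parseStep sch) s =
      endEntry (entryWord code o ++ s.1, s.2) := by
  rcases o with _ | d
  · rfl
  · rw [encodeEntry, List.foldl_append,
      foldl_parseStep_of_forall (l := (code d).map Γ'.bit)
        (List.forall_mem_map.2 fun b _ => by simp) s]
    rfl

/-- The marks of an attribute in the schema. -/
def marks {n : ℕ} (X Y A : Fin n) : Wd :=
  [.bit (decide (A = X)), .bit (decide (A = Y))]

/-- Each entry consumes the two marks of its attribute, so the remaining schema always matches the
attributes `As` still to come. The flag is set when one attribute carries both marks. -/
theorem foldl_parseStep_entries {n : ℕ} (X Y : Fin n) (sch : Wd) (t : Fin n → Option D)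
    (As : List (Fin n)) : ∀ (x y : Wd) (e : Bool) (out : List (Wd × Wd)),
    ((As.map t).flatMap (encodeEntry code)).foldl (parseStep sch)
      ([], As.flatMap (marks X Y), (x, y), e, out) =
    ([], [], (if X ∈ As then entryWord code (t X) else x,
      if Y ∈ As then entryWord code (t Y) else y), e || decide (X ∈ As ∧ X = Y), out) := by
  induction As with
  | nil => simp
  | cons A As ih =>
    intro x y e out
    have h : endEntry (entryWord code (t A) ++ ([] : Wd), (A :: As).flatMap (marks X Y), (x, y), e,
        out) = ([], As.flatMap (marks X Y), (if A = X then entryWord code (t X) else x,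
          if A = Y then entryWord code (t Y) else y), e || decide (A = X ∧ A = Y), out) := by
      by_cases hX : A = X <;> by_cases hY : A = Y
      · subst hX; subst hY; simp [endEntry, marks, headTrue]
      · subst hX; simp [endEntry, marks, headTrue, hY]
      · subst hY; simp [endEntry, marks, headTrue, hX]
      · simp [endEntry, marks, headTrue, hX, hY]
    have h' : ((A :: As).map t).flatMap (encodeEntry code) =
      encodeEntry code (t A) ++ (As.map t).flatMap (encodeEntry code) := rfl
    rw [h', List.foldl_append, foldl_parseStep_entry, h, ih]
    simp only [List.mem_cons]
    grind

/-- The opening bracket resets entry, schema and recorded values, so only the flag and the output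
survive from the previous state. -/
theorem foldl_parseStep_tuple {n : ℕ} (X Y : Fin n) (t : Fin n → Option D) (s : ParseState) :
    ((encodeTuple code t).foldl (parseStep (encodeSchema X Y)) s).2.2.2 =
      (s.2.2.2.1 || decide (X = Y), entryPair code X Y t :: s.2.2.2.2) := by
  have h := foldl_parseStep_entries code X Y (encodeSchema X Y) t (List.finRange n) [] []
    s.2.2.2.1 s.2.2.2.2
  rw [encodeTuple, List.foldl_cons, List.foldl_append, List.ofFn_eq_map]
  change (List.foldl _ (List.foldl _ ([], (List.finRange n).flatMap (marks X Y), ([], []),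
    s.2.2.2.1, s.2.2.2.2) _) _).2.2.2 = _
  rw [h]
  simp [parseStep, entryPair]

/-- The flag is set only while entries are read, hence the factor `!T.isEmpty`. -/
theorem foldl_parseStep_tuples {n : ℕ} (X Y : Fin n) (T : List (Fin n → Option D)) :
    ∀ s : ParseState, ((T.flatMap (encodeTuple code)).foldl (parseStep (encodeSchema X Y)) s).2.2.2 =
      (s.2.2.2.1 || (!T.isEmpty && decide (X = Y)),
        (T.map (entryPair code X Y)).reverse ++ s.2.2.2.2) := by
  induction T with
  | nil => simp
  | cons t T ih =>
    intro s
    rw [List.flatMap_cons, List.foldl_append, ih, foldl_parseStep_tuple]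
    cases decide (X = Y) <;> simp

theorem foldl_schemaStep {l : Wd} (hl : ∀ a ∈ l, isBit a = true) (acc : Wd) :
    l.foldl schemaStep (acc, false) = (l.reverse ++ acc, false) := by
  induction l generalizing acc with
  | nil => rfl
  | cons a l ih =>
    obtain ⟨ha, hl⟩ := List.forall_mem_cons.1 hl
    have h : schemaStep (acc, false) a = (a :: acc, false) := by simp [schemaStep, ha]
    rw [List.foldl_cons, h, ih hl]
    simp

theorem foldl_schemaStep_true (l acc : Wd) : l.foldl schemaStep (acc, true) = (acc, true) := by
  induction l with
  | nil => rfl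
  | cons a l ih => exact ih

theorem mem_encodeSchema {n : ℕ} {X Y : Fin n} {a : Γ'} (h : a ∈ encodeSchema X Y) :
    ∃ b, a = .bit b := by
  simp only [encodeSchema, List.mem_flatMap, List.mem_cons, List.not_mem_nil, or_false] at h
  obtain ⟨A, -, h | h⟩ := h
  exacts [⟨_, h⟩, ⟨_, h⟩]

theorem schemaBits_encode (I : Instance D) :
    schemaBits (I.encode code) = encodeSchema I.X I.Y := by
  have h1 : ∀ a ∈ encodeSchema I.X I.Y, isBit a = true := by
    intro a ha
    obtain ⟨b, rfl⟩ := mem_encodeSchema ha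
    cases b <;> rfl
  rw [schemaBits, Instance.encode, List.foldl_append, foldl_schemaStep h1]
  rcases I.T with _ | ⟨t, T⟩
  · simp
  · rw [List.flatMap_cons, encodeTuple, List.cons_append, List.foldl_cons]
    have h2 : ∀ acc : Wd, schemaStep (acc, false) .bra = (acc, true) := fun acc => rfl
    rw [h2, foldl_schemaStep_true]
    simp

/-- The parser also runs over the schema, but its bits only fill the current entry, and this does
not affect the flag and the output. -/
theorem parse_encode (I : Instance D) :
    parse (I.encode code) =
      (!I.T.isEmpty && decide (I.X = I.Y), (I.T.map (entryPair code I.X I.Y)).reverse) := by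
  rw [parse, schemaBits_encode, Instance.encode, List.foldl_append, foldl_parseStep_tuples,
    foldl_parseStep_of_forall]
  · simp
  · intro a ha
    obtain ⟨b, rfl⟩ := mem_encodeSchema ha
    simp

/-! ### The pairs to be matched -/

theorem values_spec (l : List Wd) :
    (values l).Nodup ∧ ∀ w, w ∈ values l ↔ w ∈ l ∧ w ≠ nullWord := by
  induction l with
  | nil => simp [values]
  | cons a l ih =>
    obtain ⟨h₁, h₂⟩ := ih
    have h : values (a :: l) = bif decide (a = nullWord) ||
      (values l).any (fun u => decide (u = a)) then values l else a :: values l := rfl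
    have h3 : (values l).any (fun u => decide (u = a)) = decide (a ∈ values l) := by
      rw [Bool.eq_iff_iff]
      simp
    rw [h, h3]
    by_cases ha : a = nullWord
    · simp only [ha, decide_true, Bool.true_or, cond_true]
      refine ⟨h₁, fun w => ?_⟩
      rw [h₂, List.mem_cons]
      grind
    · by_cases ha' : a ∈ values l
      · simp only [ha', decide_true, Bool.or_true, cond_true]
        refine ⟨h₁, fun w => ?_⟩
        have := (h₂ a).1 ha'
        rw [h₂, List.mem_cons]
        grind
      · simp only [ha, ha', decide_false, Bool.or_false, cond_false]
        refine ⟨List.nodup_cons.2 ⟨ha', h₁⟩, fun w => ?_⟩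
        rw [List.mem_cons, h₂, List.mem_cons]
        grind

/-- Only membership in `l` matters, so the reversed order of the parsed tuples does no harm. The
null word enters exactly when no value occurs, matching `ssymb` in the active domain. -/
theorem domainWords_spec {n : ℕ} (T : List (Fin n → Option D)) (A : Fin n) {l : List Wd}
    (hl : ∀ w, w ∈ l ↔ ∃ t ∈ T, entryWord code (t A) = w) :
    (domainWords l).Nodup ∧
      ∀ w, w ∈ domainWords l ↔ ∃ a ∈ activeDomain (dom := fun _ => D) T A, extWord code a = w := by
  obtain ⟨h₁, h₂⟩ := values_spec l
  have h₃ : ∀ w, w ∈ values l ↔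
      ∃ d ∈ occurringValues (dom := fun _ => D) T A, extWord code (.val d) = w := by
    intro w
    rw [h₂, hl]
    constructor
    · rintro ⟨⟨t, ht, rfl⟩, h⟩
      rcases hd : t A with _ | d
      · rw [hd] at h
        exact absurd rfl h
      · exact ⟨d, ⟨t, ht, hd⟩, rfl⟩
    · rintro ⟨d, ⟨t, ht, hd⟩, rfl⟩
      exact ⟨⟨t, ht, congrArg _ hd⟩, entryWord_some_ne_nullWord code d⟩
  rcases hv : values l with _ | ⟨u, r⟩
  · have hd : domainWords l = [nullWord] := by simp [domainWords, hv]
    have he : occurringValues (dom := fun _ => D) T A = ∅ := by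
      refine Set.eq_empty_of_forall_notMem fun d hd => ?_
      have := (h₃ _).2 ⟨d, hd, rfl⟩
      rw [hv] at this
      exact absurd this List.not_mem_nil
    rw [hd]
    refine ⟨List.nodup_singleton _, fun w => ?_⟩
    rw [List.mem_singleton, activeDomain, he]
    constructor
    · rintro rfl
      exact ⟨.ssymb, .inr ⟨rfl, rfl⟩, rfl⟩
    · rintro ⟨a, ⟨d, hd, -⟩ | ⟨rfl, -⟩, rfl⟩
      · exact absurd hd (Set.notMem_empty d)
      · rfl
  · have hd : domainWords l = values l := by simp [domainWords, hv]
    have he : occurringValues (dom := fun _ => D) T A ≠ ∅ := by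
      obtain ⟨d, hd, -⟩ := (h₃ u).1 (by rw [hv]; exact List.mem_cons_self)
      exact Set.Nonempty.ne_empty ⟨d, hd⟩
    rw [hd]
    refine ⟨h₁, fun w => (h₃ w).trans ?_⟩
    constructor
    · rintro ⟨d, hd, rfl⟩
      exact ⟨_, .inl ⟨d, hd, rfl⟩, rfl⟩
    · rintro ⟨a, ⟨d, hd, rfl⟩ | ⟨-, h⟩, rfl⟩
      · exact ⟨d, hd, rfl⟩
      · exact absurd h he

theorem cells_spec {n : ℕ} (T : List (Fin n → Option D)) (X Y : Fin n) {l : List (Wd × Wd)}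
    (hl : l.Perm (T.map (entryPair code X Y))) :
    (cells l).Nodup ∧ ∀ c, c ∈ cells l ↔
      ∃ p : activeDomain (dom := fun _ => D) T X × activeDomain (dom := fun _ => D) T Y,
        (extWord code p.1.1, extWord code p.2.1) = c := by
  obtain ⟨h₁, h₂⟩ := domainWords_spec code T X (l := l.map Prod.fst) fun w => by
    rw [(hl.map Prod.fst).mem_iff]
    simp [entryPair]
  obtain ⟨h₃, h₄⟩ := domainWords_spec code T Y (l := l.map Prod.snd) fun w => by
    rw [(hl.map Prod.snd).mem_iff]
    simp [entryPair]
  refine ⟨h₁.product h₃, ?_⟩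
  rintro ⟨u, w⟩
  refine (List.mem_product (l₁ := domainWords (l.map Prod.fst))).trans ?_
  rw [h₂, h₄]
  constructor
  · rintro ⟨⟨a, ha, rfl⟩, ⟨b, hb, rfl⟩⟩
    exact ⟨(⟨a, ha⟩, ⟨b, hb⟩), rfl⟩
  · rintro ⟨⟨⟨a, ha⟩, ⟨b, hb⟩⟩, h⟩
    obtain ⟨rfl, rfl⟩ := Prod.mk.inj h
    exact ⟨⟨a, ha, rfl⟩, ⟨b, hb, rfl⟩⟩

theorem similar_iff {code : D → List Bool} (hcode : Function.Injective code) {n : ℕ} (X Y : Fin n)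
    (t : Fin n → Option D) (a b : Ext D) :
    similar (decide (X = Y)) (extWord code a, extWord code b) (entryPair code X Y t) = true ↔
      SimilarToPair (dom := fun _ => D) t X Y a b := by
  have h1 : ∀ (o : Option D) (a : Ext D),
      (entryWord code o = nullWord ∨ entryWord code o = extWord code a) ↔
        (o.map Ext.val = some a ∨ o.map Ext.val = none) := by
    rintro (_ | d) a
    · simp [entryWord]
    · have h2 : entryWord code (some d) = extWord code (.val d) := rfl
      simp only [entryWord_some_ne_nullWord, false_or, Option.map_some, Option.some.injEq,
        reduceCtorEq, or_false]
      rw [h2, (extWord_injective hcode).eq_iff]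
  have h2 : similar (decide (X = Y)) (extWord code a, extWord code b) (entryPair code X Y t) = true ↔
      (((t X).map Ext.val = some a ∨ (t X).map Ext.val = none) ∧
        ((t Y).map Ext.val = some b ∨ (t Y).map Ext.val = none)) ∧ (X = Y → a = b) := by
    rw [← h1, ← h1, ← (extWord_injective hcode).eq_iff (a := a)]
    rw [similar, Bool.and_eq_true, Bool.and_eq_true, Bool.or_eq_true, Bool.or_eq_true,
      Bool.or_eq_true, imp_iff_not_or, Bool.not_eq_true', decide_eq_false_iff_not]
    exact and_congr (and_congr (or_congr decide_eq_true_iff decide_eq_true_iff)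
      (or_congr decide_eq_true_iff decide_eq_true_iff)) (or_congr Iff.rfl decide_eq_true_iff)
  rw [h2]
  constructor
  · rintro ⟨⟨hX, hY⟩, hXY⟩
    -- The value `b` is used at all attributes other than `X`; if `Y = X`, then `a = b` makes the
    -- choice consistent.
    refine ⟨fun A => if A = X then some a else some b, if_pos rfl, ?_, ?_⟩
    · by_cases h : Y = X
      · simp [h, hXY h.symm]
      · simp [h]
    · rintro A (rfl | rfl)
      · rcases hX with h | h
        · exact .inl (by simp [Tuple.toExt, h])
        · exact .inr (.inl h)
      · rcases hY with h | h
        · by_cases h' : A = X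
          · exact .inl (by dsimp only; rw [if_pos h', hXY h'.symm]; exact h)
          · exact .inl (by simp [Tuple.toExt, h, h'])
        · exact .inr (.inl h)
  · rintro ⟨s, hX, hY, hs⟩
    refine ⟨⟨?_, ?_⟩, ?_⟩
    · have := hs X (.inl rfl)
      rw [hX] at this
      simpa [Tuple.toExt] using this
    · have := hs Y (.inr rfl)
      rw [hY] at this
      simpa [Tuple.toExt] using this
    · rintro rfl
      exact Option.some.inj (hX.symm.trans hY)

/-- Lists of words must be translated into positions, since different tuples may give the same pair
of words. A sublist up to permutation yields an injection of indices (`idxInj`). In the other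
direction, `f` and the absence of repeated cells give distinct positions of `T`. -/
theorem matchable_iff {code : D → List Bool} (hcode : Function.Injective code) {n : ℕ}
    (T : Table (Fin n) fun _ => D) (X Y : Fin n) {l : List (Wd × Wd)}
    (hl : l.Perm (T.map (entryPair code X Y))) :
    Auction.Matchable (similar (decide (X = Y))) (cells l) l ↔
      ∃ f : activeDomain T X × activeDomain T Y → Fin T.length,
        Function.Injective f ∧ ∀ p, SimilarToPair (T.get (f p)) X Y p.1.1 p.2.1 := by
  classical
  obtain ⟨hnd, hmem⟩ := cells_spec code T X Y hl
  constructor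
  · rintro ⟨P, hP₁, hP₂, hP₃⟩
    have hsub := hP₂.trans hl.subperm
    have h1 : ∀ p : activeDomain T X × activeDomain T Y, ∃ i : Fin P.length,
        (P.get i).1 = (extWord code p.1.1, extWord code p.2.1) := by
      intro p
      obtain ⟨q, hq, hqp⟩ := List.mem_map.1 (hP₁.symm.subset ((hmem _).2 ⟨p, rfl⟩))
      obtain ⟨i, rfl⟩ := List.get_of_mem hq
      exact ⟨i, hqp⟩
    choose g hg using h1
    have hglt : ∀ p, (g p : ℕ) < (P.map Prod.snd).length := fun p => by simp
    have hlen : (T.map (entryPair code X Y)).length = T.length := List.length_map _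
    refine ⟨fun p => (hsub.idxInj ⟨g p, hglt p⟩).cast hlen, fun p q hpq => ?_, fun p => ?_⟩
    · have h2 : (⟨g p, hglt p⟩ : Fin (P.map Prod.snd).length) = ⟨g q, hglt q⟩ :=
        hsub.idxInj_injective (Fin.cast_injective hlen hpq)
      have h3 : g p = g q := Fin.ext (Fin.mk.inj h2)
      have h4 := (hg p).symm.trans ((congrArg (fun i => (P.get i).1) h3).trans (hg q))
      obtain ⟨h5, h6⟩ := Prod.mk.inj h4
      exact Prod.ext (Subtype.ext (extWord_injective hcode h5))
        (Subtype.ext (extWord_injective hcode h6))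
    · rw [← similar_iff hcode, ← hg p]
      have h2 := hsub.getElem_idxInj_eq_getElem (i := ⟨g p, hglt p⟩)
      simp only [List.getElem_map] at h2
      have h3 : entryPair code X Y (T.get ((hsub.idxInj ⟨g p, hglt p⟩).cast hlen)) =
          (P.get (g p)).2 := h2
      rw [h3]
      exact hP₃ _ (List.get_mem P (g p))
  · rintro ⟨f, hf, hs⟩
    choose g hg using fun c : {c // c ∈ cells l} => (hmem c.1).1 c.2
    refine ⟨(cells l).attach.map fun c => (c.1, entryPair code X Y (T.get (f (g c)))), ?_, ?_, ?_⟩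
    · rw [List.map_map]
      exact List.Perm.of_eq (List.attach_map_subtype_val (cells l))
    · refine List.Subperm.trans ?_ hl.symm.subperm
      have h1 : ((cells l).attach.map fun c => f (g c)).Nodup := by
        refine (List.nodup_attach.2 hnd).map fun c d hcd => ?_
        have h2 := hf hcd
        exact Subtype.ext ((hg c).symm.trans (h2 ▸ hg d))
      have h2 : ((cells l).attach.map fun c => f (g c)).Subperm (List.finRange T.length) :=
        List.subperm_of_subset h1 fun i _ => List.mem_finRange i
      obtain ⟨l', hl', hl''⟩ := h2
      refine ⟨l'.map fun i => entryPair code X Y (T.get i), ?_, ?_⟩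
      · rw [List.map_map]
        refine (hl'.map _).trans (List.Perm.of_eq ?_)
        rw [List.map_map]
        rfl
      · refine (hl''.map _).trans ?_
        have h3 : ((List.finRange T.length).map fun i => entryPair code X Y (T.get i)) =
            T.map (entryPair code X Y) := List.ext_get (by simp) fun i h h' => by simp
        exact h3 ▸ List.Sublist.refl _
    · intro q hq
      obtain ⟨c, -, rfl⟩ := List.mem_map.1 hq
      have h1 := (similar_iff hcode X Y (T.get (f (g c))) _ _).2 (hs (g c))
      rwa [hg c] at h1

theorem decideWord_encode {code : D → List Bool} (hcode : Function.Injective code)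
    (I : Instance D) : decideWord (I.encode code) = true ↔ I.Yes := by
  rw [decideWord, parse_encode]
  by_cases hT : I.T = []
  -- The empty table satisfies every cross join vacuously, although its pair of active domains is
  -- nonempty and could not be matched; hence the separate test in `decideWord`.
  · have h : I.Yes := by
      refine ⟨[], ⟨⟨by rw [hT]; exact .nil, by simp⟩, by simp⟩, by simp [SatisfiesCJ]⟩
    simp [hT, h]
  · have hT' : I.T.isEmpty = false := by simpa using hT
    obtain ⟨hnd, -⟩ := cells_spec code I.T I.X I.Y (List.reverse_perm _)
    rw [Instance.Yes, satisfiesSpCJ_iff hT, ← matchable_iff hcode I.T I.X I.Y (List.reverse_perm _),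
      ← runAuction_iff _ hnd]
    simp [hT']

end TreeMachine

theorem proposition4 :
    (∀ (D : Type) (code : D → List Bool), Function.Injective code →
      SpCJ.InP (SpCJ.Instance.encode code) (SpCJ.Instance.Yes (D := D))) ∧
    (∀ (R : Type u) (dom : R → Type v) (X Y : R) (T : SpCJ.Table R dom), T ≠ [] →
      (SpCJ.SatisfiesSpCJ T {X} {Y} ↔
        ∃ M : (SpCJ.pairGraph T X Y).Subgraph,
          M.IsMatching ∧ Set.range Sum.inr ⊆ M.verts)) :=
  ⟨fun _ _ hcode => TreeMachine.inP_of_pt TreeMachine.PT.decideWord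
      (TreeMachine.decideWord_encode hcode),
    fun _ _ X Y T hT => (SpCJ.satisfiesSpCJ_iff hT X Y).trans
      (SpCJ.exists_injective_iff_exists_isMatching T X Y)⟩
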